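/- A graph is a $1$-dimensional CW-complex (loops and multiple edges allowed); a forest is a (possibly empty) graph containing no embedded circle. Let $F$ be a finite connected graph, let $H\subset F$ be a subgraph (not necessarily connected, possibly empty), and let $\psi:H\to F$ be a cellular immersion, i.e. a locally injective map sending vertices to vertices; thus each edge of $H$ is sent along a non-trivial edge path without backtracking. Let $X$ be the mapping torus of $\psi$, that is, the $2$-complex $$X=\bigl(F\sqcup (H\times[0,1])\bigr)\big/\{(x,0)\sim x,\ (x,1)\sim\psi(x)\ :\ x\in H\},$$ whose cells are the vertices and edges of $F$, one further edge $\{v\}\times[0,1]$ for each vertex $v$ of $H$, and one $2$-cell $e\times[0,1]$ for each edge $e$ of $H$. Let $\psi^0=\mathrm{id}_F$, and let $\psi^{n+1}$ be the composite $\psi\circ\psi^{n}$, defined on the set of points that $\psi^{n}$ maps into $H$. Put $\psi^{-n}(H)=(\psi^{n})^{-1}(H)$; this is a subset of $F$ that need not be a subgraph, but becomes one after subdividing edges. The directed height of $\psi$ is $$\inf\{n\ge 0:\ \psi^{-n}(H)\ \text{is homeomorphic to a forest}\}\in\{0,1,2,\dots\}\cup\{\infty\}.$$ A map of $2$-complexes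 is combinatorial if it maps open cells homeomorphically onto open cells, and it is an immersion if it is locally injective. A $2$-complex is collapsed if it has no free faces, and an edge is isolated if it is not a face of a $2$-cell. A $2$-complex $X$ has negative immersions if there is a constant $c>0$ such that for every combinatorial immersion $Y\to X$ with $Y$ a compact, connected, collapsed $2$-complex without isolated edges, either $\pi_1Y$ is trivial or $\chi(Y)\le -c\,|Y|_2$, where $|Y|_2$ is the number of $2$-cells of $Y$. Theorem. $X$ has negative immersions if and only if $\psi$ has finite directed height, i.e. if and only if $\psi^{-n}(H)$ is homeomorphic to a forest for some $n\ge 0$. -/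

import Mathlib

universe u

namespace PartialTorus

/-- A graph: a one-dimensional CW complex given by its vertices, its edges (each with a chosen
orientation) and the initial and terminal vertex of every edge. Loops and multiple edges are
allowed. -/
structure MGraph where
  V : Type u
  E : Type u
  ini : E → V
  ter : E → V

namespace MGraph

/-- An edge traversed forwards (`true`) or backwards (`false`). The darts with source `v` are
also the half-edges at `v`; a loop at `v` contributes two of them. -/
abbrev Dart (G : MGraph.{u}) : Type u := G.E × Bool

variable {G : MGraph.{u}}

def src (d : G.Dart) : G.V := if d.2 then G.ini d.1 else G.ter d.1

def tgt (d : G.Dart) : G.V := if d.2 then G.ter d.1 else G.ini d.1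

def rev (d : G.Dart) : G.Dart := (d.1, !d.2)

/-- `IsPath x l y`: the list of darts `l` is an edge path from `x` to `y`. -/
def IsPath : G.V → List G.Dart → G.V → Prop
  | x, [], y => x = y
  | x, d :: l, y => src d = x ∧ IsPath (tgt d) l y

/-- The same path traversed backwards. -/
def revPath (l : List G.Dart) : List G.Dart := (l.map rev).reverse

lemma src_rev (d : G.Dart) : src (rev d) = tgt d := by
  rcases d with ⟨e, _ | _⟩ <;> simp [src, tgt, rev]

lemma tgt_rev (d : G.Dart) : tgt (rev d) = src d := by
  rcases d with ⟨e, _ | _⟩ <;> simp [src, tgt, rev]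

lemma isPath_append {x y : G.V} {l m : List G.Dart} :
    IsPath x (l ++ m) y ↔ ∃ z, IsPath x l z ∧ IsPath z m y := by
  induction l generalizing x with
  | nil => simp [IsPath]
  | cons d l ih => simp [IsPath, ih, and_assoc]

lemma IsPath.revPath {x y : G.V} {l : List G.Dart} (h : IsPath x l y) :
    IsPath y (revPath l) x := by
  induction l generalizing x with
  | nil => exact Eq.symm h
  | cons d l ih =>
    obtain ⟨h1, h2⟩ := h
    have h3 := ih h2
    simp only [MGraph.revPath, List.map_cons, List.reverse_cons] at h3 ⊢
    exact isPath_append.2 ⟨_, h3, by simp [IsPath, src_rev, tgt_rev, h1]⟩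

lemma IsPath.src_getElem_zero {x y : G.V} {l : List G.Dart} (h : IsPath x l y)
    (hl : 0 < l.length) : src l[0] = x := by
  cases l with
  | nil => simp at hl
  | cons d l => exact h.1

lemma IsPath.src_getElem_succ {x y : G.V} {l : List G.Dart} (h : IsPath x l y) (j : ℕ)
    (hj : j + 1 < l.length) : src l[j + 1] = tgt l[j] := by
  induction l generalizing x j with
  | nil => simp at hj
  | cons d l ih =>
    cases j with
    | zero => simpa using h.2.src_getElem_zero (by simpa using hj)
    | succ j => simpa using ih h.2 j (by simpa using hj)

lemma IsPath.tgt_getElem_last {x y : G.V} {l : List G.Dart} (h : IsPath x l y) (j : ℕ)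
    (hj : j + 1 = l.length) : tgt (l[j]'(by omega)) = y := by
  induction l generalizing x j with
  | nil => simp at hj
  | cons d l ih =>
    cases j with
    | zero =>
      obtain rfl : l = [] := by simpa using hj.symm
      exact h.2
    | succ j => simpa using ih h.2 j (by simpa using hj)

/-- Connected: non-empty, and any two vertices are joined by an edge path. -/
def Connected (G : MGraph.{u}) : Prop :=
  Nonempty G.V ∧ ∀ x y : G.V, ∃ l : List G.Dart, IsPath x l y

/-- `l` traverses an embedded circle once: a non-empty closed edge path that repeats neither a
vertex nor an edge. -/
def IsEmbeddedCircle (l : List G.Dart) : Prop :=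
  l ≠ [] ∧ (∃ x, IsPath x l x) ∧ (l.map src).Nodup ∧ (l.map Prod.fst).Nodup

/-- A forest: a graph, possibly empty, without embedded circles. -/
def IsForest (G : MGraph.{u}) : Prop := ∀ l : List G.Dart, ¬ IsEmbeddedCircle l

/-- A subgraph: a set of vertices and a set of edges containing the endpoints of its edges. -/
structure Subgraph (G : MGraph.{u}) where
  verts : Set G.V
  edges : Set G.E
  ini_mem : ∀ e ∈ edges, G.ini e ∈ verts
  ter_mem : ∀ e ∈ edges, G.ter e ∈ verts

/-- A subgraph as a graph in its own right. -/
def Subgraph.toGraph (H : Subgraph G) : MGraph.{u} where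
  V := H.verts
  E := H.edges
  ini e := ⟨G.ini e, H.ini_mem e e.2⟩
  ter e := ⟨G.ter e, H.ter_mem e e.2⟩

end MGraph

open MGraph

/-- A cellular map of graphs that collapses no edge, up to reparametrisation of the edges:
vertices go to vertices and every edge is sent along a non-trivial edge path. (A locally injective
map collapses no edge, so every cellular immersion is of this kind.) -/
structure CellularMap (G F : MGraph.{u}) where
  vmap : G.V → F.V
  emap : G.E → List F.Dart
  isPath : ∀ e, IsPath (vmap (G.ini e)) (emap e) (vmap (G.ter e))
  ne_nil : ∀ e, emap e ≠ []

namespace CellularMap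

variable {G F : MGraph.{u}}

/-- The image path of an edge traversed in a given direction. -/
def dartMap (φ : CellularMap G F) (d : G.Dart) : List F.Dart :=
  if d.2 then φ.emap d.1 else revPath (φ.emap d.1)

lemma isPath_dartMap (φ : CellularMap G F) (d : G.Dart) :
    IsPath (φ.vmap (src d)) (φ.dartMap d) (φ.vmap (tgt d)) := by
  rcases d with ⟨e, _ | _⟩
  · simpa [src, tgt, dartMap] using (φ.isPath e).revPath
  · simpa [src, tgt, dartMap] using φ.isPath e

lemma dartMap_ne_nil (φ : CellularMap G F) (d : G.Dart) : φ.dartMap d ≠ [] := by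
  rcases d with ⟨e, _ | _⟩ <;> simp [dartMap, revPath, φ.ne_nil e]

/-- Local injectivity: in the interior of an edge this says that its image path has no
backtracking; at a vertex it says that different half-edges start in different directions. -/
structure IsImmersion (φ : CellularMap G F) : Prop where
  reduced : ∀ e, (φ.emap e).IsChain (fun a b => b ≠ rev a)
  injective_at_vertex : ∀ d d' : G.Dart, src d = src d' →
    (φ.dartMap d).head? = (φ.dartMap d').head? → d = d'

/-- The subdivision of `G` for which `φ` becomes combinatorial: an edge `e` with image path of
length `k` is divided into the edges `(e, 0), …, (e, k - 1)`, by the new vertices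
`(e, 0), …, (e, k - 2)`, where `(e, j)` lies between the edges `(e, j)` and `(e, j + 1)`. -/
def subdivision (φ : CellularMap G F) : MGraph.{u} where
  V := G.V ⊕ (Σ e : G.E, Fin ((φ.emap e).length - 1))
  E := Σ e : G.E, Fin (φ.emap e).length
  ini s :=
    if h : s.2.1 = 0 then Sum.inl (G.ini s.1)
    else Sum.inr ⟨s.1, ⟨s.2.1 - 1, by have := s.2.2; omega⟩⟩
  ter s :=
    if h : s.2.1 + 1 = (φ.emap s.1).length then Sum.inl (G.ter s.1)
    else Sum.inr ⟨s.1, ⟨s.2.1, by have := s.2.2; omega⟩⟩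

end CellularMap

/-- A graph with a combinatorial map to `F`: vertices go to vertices and open edges
homeomorphically onto open edges (with or against the orientation). -/
structure GraphOver (F : MGraph.{u}) where
  graph : MGraph.{u}
  vmap : graph.V → F.V
  emap : graph.E → F.Dart
  src_emap : ∀ e, src (emap e) = vmap (graph.ini e)
  tgt_emap : ∀ e, tgt (emap e) = vmap (graph.ter e)

namespace GraphOver

variable {F : MGraph.{u}}

/-- `F` with the identity map. -/
def refl (F : MGraph.{u}) : GraphOver F where
  graph := F
  vmap v := v
  emap e := (e, true)
  src_emap e := by simp [src]
  tgt_emap e := by simp [tgt]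

/-- The preimage of a subgraph. -/
def preimage (P : GraphOver F) (H : Subgraph F) : Subgraph P.graph where
  verts := {v | P.vmap v ∈ H.verts}
  edges := {e | (P.emap e).1 ∈ H.edges}
  ini_mem e he := by
    have h1 := H.ini_mem _ he
    have h2 := H.ter_mem _ he
    have h3 := P.src_emap e
    simp only [Set.mem_ofPred_eq, ← h3, src]
    split_ifs <;> assumption
  ter_mem e he := by
    have h1 := H.ini_mem _ he
    have h2 := H.ter_mem _ he
    have h3 := P.tgt_emap e
    simp only [Set.mem_ofPred_eq, ← h3, tgt]
    split_ifs <;> assumption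

/-- The composite of (the restriction of) `P → F` to the preimage of `H` with `ψ : H → F`. -/
def comp (P : GraphOver F) {H : Subgraph F} (ψ : CellularMap H.toGraph F) :
    CellularMap (P.preimage H).toGraph F where
  vmap v := ψ.vmap ⟨P.vmap v.1, v.2⟩
  emap e := ψ.dartMap (⟨(P.emap e.1).1, e.2⟩, (P.emap e.1).2)
  isPath e := by
    have h := ψ.isPath_dartMap (⟨(P.emap e.1).1, e.2⟩, (P.emap e.1).2)
    convert h using 2
    · refine congrArg ψ.vmap (Subtype.ext ?_)
      have := P.src_emap e.1
      simp only [src] at this ⊢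
      simp only [Subgraph.toGraph, ← this]
      split_ifs <;> rfl
    · refine congrArg ψ.vmap (Subtype.ext ?_)
      have := P.tgt_emap e.1
      simp only [tgt] at this ⊢
      simp only [Subgraph.toGraph, ← this]
      split_ifs <;> rfl
  ne_nil e := ψ.dartMap_ne_nil _

/-- A cellular map `φ : G → F`, as a combinatorial map from the subdivided `G`. -/
def ofCellularMap {G : MGraph.{u}} (φ : CellularMap G F) : GraphOver F where
  graph := φ.subdivision
  vmap := Sum.elim φ.vmap (fun s => tgt ((φ.emap s.1)[s.2.1]'(by have := s.2.2; omega)))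
  emap s := (φ.emap s.1)[s.2.1]
  src_emap s := by
    obtain ⟨e, ⟨j, hj⟩⟩ := s
    cases j with
    | zero => simpa [CellularMap.subdivision] using (φ.isPath e).src_getElem_zero hj
    | succ j => simpa [CellularMap.subdivision] using (φ.isPath e).src_getElem_succ j hj
  tgt_emap s := by
    obtain ⟨e, ⟨j, hj⟩⟩ := s
    by_cases h : j + 1 = (φ.emap e).length
    · simpa [CellularMap.subdivision, h] using (φ.isPath e).tgt_getElem_last j h
    · simp [CellularMap.subdivision, h]

end GraphOver

namespace CellularMap

variable {F : MGraph.{u}} {H : Subgraph F}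

/-- The `n`-fold generalized composition `ψⁿ` of `ψ : H → F` with itself, as a combinatorial map to
`F` from its subdivided domain: `ψ⁰` is the identity of `F`, and `ψⁿ⁺¹` is `ψ ∘ ψⁿ` on the set of
points that `ψⁿ` maps into `H`. -/
def iterate (ψ : CellularMap H.toGraph F) : ℕ → GraphOver F
  | 0 => GraphOver.refl F
  | n + 1 => GraphOver.ofCellularMap ((iterate ψ n).comp ψ)

/-- `ψ⁻ⁿ(H) = (ψⁿ)⁻¹(H)`, which need not be a subgraph of `F`, as a graph: it is a subgraph of the
subdivided domain of `ψⁿ`. -/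
def iteratedPreimage (ψ : CellularMap H.toGraph F) (n : ℕ) : MGraph.{u} :=
  ((iterate ψ n).preimage H).toGraph

/-- The directed height: the least `n` for which `ψ⁻ⁿ(H)` is a forest, and `⊤` if there is none. -/
noncomputable def directedHeight (ψ : CellularMap H.toGraph F) : ℕ∞ :=
  ⨅ (n : ℕ) (_ : (ψ.iteratedPreimage n).IsForest), (n : ℕ∞)

lemma directedHeight_lt_top_iff (ψ : CellularMap H.toGraph F) :
    ψ.directedHeight < ⊤ ↔ ∃ n, (ψ.iteratedPreimage n).IsForest := by
  simp [directedHeight, iInf_lt_iff]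

end CellularMap

/-- A combinatorial `2`-complex: a graph together with `2`-cells, each attached along a non-empty
closed edge path. -/
structure TwoComplex where
  graph : MGraph.{u}
  C : Type u
  bdry : C → List graph.Dart
  bdry_ne_nil : ∀ c, bdry c ≠ []
  bdry_closed : ∀ c, ∃ x, IsPath x (bdry c) x

namespace TwoComplex

/-- A `2`-complex is compact iff it has finitely many cells. -/
def IsFinite (Y : TwoComplex.{u}) : Prop := Finite Y.graph.V ∧ Finite Y.graph.E ∧ Finite Y.C

/-- The Euler characteristic (of a finite complex). -/
noncomputable def eulerChar (Y : TwoComplex.{u}) : ℤ :=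
  (Nat.card Y.graph.V : ℤ) - Nat.card Y.graph.E + Nat.card Y.C

/-- An edge is isolated if it is not a face of a `2`-cell. -/
def IsIsolatedEdge (Y : TwoComplex.{u}) (e : Y.graph.E) : Prop :=
  ∀ c, e ∉ (Y.bdry c).map Prod.fst

/-- An edge is a free face if the attaching paths of all the `2`-cells together traverse it exactly
once. -/
def IsFreeEdge (Y : TwoComplex.{u}) (e : Y.graph.E) : Prop :=
  ∃! s : (Σ c : Y.C, Fin (Y.bdry c).length), ((Y.bdry s.1)[s.2.1]).1 = e

/-- A vertex is a free face if exactly one half-edge starts at it, and that edge is isolated. -/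
def IsFreeVertex (Y : TwoComplex.{u}) (v : Y.graph.V) : Prop :=
  (∃! d : Y.graph.Dart, src d = v) ∧ ∀ d : Y.graph.Dart, src d = v → Y.IsIsolatedEdge d.1

/-- Collapsed: no free faces. -/
def IsCollapsed (Y : TwoComplex.{u}) : Prop :=
  (∀ e, ¬ Y.IsFreeEdge e) ∧ ∀ v, ¬ Y.IsFreeVertex v

/-- The closed edge paths based at `v`. -/
def Loop (Y : TwoComplex.{u}) (v : Y.graph.V) : Type u :=
  {l : List Y.graph.Dart // IsPath v l v}

/-- Elementary homotopies of closed paths: inserting a backtracking `d d⁻¹`, or the attaching path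
of a `2`-cell. -/
inductive HomotopyStep (Y : TwoComplex.{u}) (v : Y.graph.V) : Y.Loop v → Y.Loop v → Prop
  | backtrack (a b : Y.Loop v) (p q : List Y.graph.Dart) (d : Y.graph.Dart)
      (ha : a.1 = p ++ q) (hb : b.1 = p ++ [d, rev d] ++ q) : HomotopyStep Y v a b
  | cell (a b : Y.Loop v) (p q : List Y.graph.Dart) (c : Y.C)
      (ha : a.1 = p ++ q) (hb : b.1 = p ++ Y.bdry c ++ q) : HomotopyStep Y v a b

/-- The (underlying set of the) fundamental group at `v`: closed edge paths at `v` modulo the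
equivalence relation generated by elementary homotopies. -/
def Pi1 (Y : TwoComplex.{u}) (v : Y.graph.V) : Type u := Quot (Y.HomotopyStep v)

/-- All fundamental groups are trivial. -/
def HasTrivialPi1 (Y : TwoComplex.{u}) : Prop := ∀ v, Subsingleton (Y.Pi1 v)

/-- A combinatorial map of `2`-complexes, mapping open cells homeomorphically onto open cells of the
same dimension. The orientations of the edges of `Y` and the base points and directions of the
attaching paths of its `2`-cells are the ones pulled back from `X`. Any combinatorial map takes this
form when these auxiliary choices in the source are made accordingly. -/
structure CombMap (Y X : TwoComplex.{u}) where
  vmap : Y.graph.V → X.graph.V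
  emap : Y.graph.E → X.graph.E
  cmap : Y.C → X.C
  ini_emap : ∀ e, X.graph.ini (emap e) = vmap (Y.graph.ini e)
  ter_emap : ∀ e, X.graph.ter (emap e) = vmap (Y.graph.ter e)
  bdry_cmap : ∀ c, X.bdry (cmap c) = (Y.bdry c).map (fun d => (emap d.1, d.2))

/-- Local injectivity, expressed by the links of vertices: half-edges at a common vertex with the
same image are equal, and so are corners of `2`-cells at a common vertex. The corners of a `2`-cell
are indexed by the positions `i` in its attaching path, and the map sends the `i`-th corner of `c`
to the `i`-th corner of its image. (Injectivity on corners implies local injectivity along the open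
edges.) -/
structure CombMap.IsImmersion {Y X : TwoComplex.{u}} (f : CombMap Y X) : Prop where
  injective_on_darts : ∀ d d' : Y.graph.Dart, src d = src d' →
    f.emap d.1 = f.emap d'.1 → d.2 = d'.2 → d = d'
  injective_on_corners : ∀ (c c' : Y.C) (i : ℕ) (hi : i < (Y.bdry c).length)
    (hi' : i < (Y.bdry c').length), f.cmap c = f.cmap c' →
    src (Y.bdry c)[i] = src (Y.bdry c')[i] → c = c'

/-- Negative immersions: there is `c > 0` such that every compact, connected, collapsed `Y` without
isolated edges that has a combinatorial immersion to `X` satisfies `π₁Y = 1` or `χ(Y) ≤ -c|Y|₂`. -/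
def NegativeImmersions (X : TwoComplex.{u}) : Prop :=
  ∃ c : ℝ, 0 < c ∧ ∀ (Y : TwoComplex.{u}) (f : CombMap Y X), f.IsImmersion →
    Y.IsFinite → Y.graph.Connected → Y.IsCollapsed → (∀ e, ¬ Y.IsIsolatedEdge e) →
    Y.HasTrivialPi1 ∨ (Y.eulerChar : ℝ) ≤ -c * (Nat.card Y.C : ℝ)

end TwoComplex

section MappingTorus

variable {F : MGraph.{u}} {H : Subgraph F}

/-- The `1`-skeleton of the mapping torus: the (vertical) edges of `F`, and for each vertex `v` of
`H` a horizontal edge `{v} × [0, 1]` from `v` to `ψ(v)`. -/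
def torusGraph (ψ : CellularMap H.toGraph F) : MGraph.{u} where
  V := F.V
  E := F.E ⊕ H.verts
  ini := Sum.elim F.ini (fun v => v.1)
  ter := Sum.elim F.ter (fun v => ψ.vmap v)

/-- A vertical dart. -/
def vertical (ψ : CellularMap H.toGraph F) (d : F.Dart) : (torusGraph ψ).Dart := (Sum.inl d.1, d.2)

lemma IsPath.map_vertical (ψ : CellularMap H.toGraph F) {x y : F.V} {l : List F.Dart}
    (h : IsPath x l y) : IsPath (G := torusGraph ψ) x (l.map (vertical ψ)) y := by
  induction l generalizing x with
  | nil => exact h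
  | cons d l ih => exact ⟨h.1, ih h.2⟩

/-- The mapping torus of `ψ : H → F`, that is, `F ⊔ (H × [0, 1])` with `(x, 0) ∼ x` and
`(x, 1) ∼ ψ(x)` for `x ∈ H`. Each edge `e` of `H` gives a `2`-cell `e × [0, 1]`, attached along `e`,
the horizontal edge at the end of `e`, the path `ψ(e)` backwards, and the horizontal edge at the
beginning of `e` backwards. -/
def mappingTorus (ψ : CellularMap H.toGraph F) : TwoComplex.{u} where
  graph := torusGraph ψ
  C := H.edges
  bdry e := (Sum.inl e.1, true) :: (Sum.inr (H.toGraph.ter e), true) ::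
    ((revPath (ψ.emap e)).map (vertical ψ) ++
      ([(Sum.inr (H.toGraph.ini e), false)] : List (torusGraph ψ).Dart))
  bdry_ne_nil e := by simp
  bdry_closed e := by
    have h := IsPath.map_vertical ψ (ψ.isPath e).revPath
    exact ⟨F.ini e.1, rfl, rfl, isPath_append.2 ⟨_, h, rfl, rfl⟩⟩

end MappingTorus

end PartialTorus

/-! Call a set of edges a core if no vertex is the endpoint of exactly one of its half-edges. A
graph with finitely many vertices is a forest iff it has no non-empty core. Unlike circles, cores
are preserved by unions and by images under immersions, and a core in a subdivision consists of
whole edges. Hence `ψ⁻ⁿ(H)` is not a forest iff `F` has a non-empty core whose edges stay in `H`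
under `ψ⁰, …, ψⁿ` (`not_isForest_iteratedPreimage_iff`).

If no `ψ⁻ⁿ(H)` is a forest, finiteness of `F` gives a core that survives all iterates, and then a
core that `ψ` maps into itself (`exists_isInvariantCore`). The mapping torus of `ψ` on a minimal
invariant core is a subcomplex of `X`; minimality makes it connected and collapsed. It has 2-cells
and `χ = 0`, and counting horizontal edges with sign detects a non-trivial loop, so no constant `c`
works (`not_negativeImmersions`).

Conversely, any relevant `Y` is the mapping torus of a partial map `φ : S → Γ`, where `Γ` is the
preimage of `F` and `S` lies in `Γ` (`toPartialLift`). Counting half-edges shows that the frontier,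
formed by the vertices of `S` incident to an edge outside `S`, has at most `-2χ(Y)` elements
(`card_frontier_le`). Around a vertex far from the frontier, one can move upstream against `φ`
repeatedly and find a large ball in `Γ` whose edges survive `n` iterates. A non-backtracking path in
this ball projects to one in `F`, which soon runs around a circle; so `ψ⁻ⁿ(H)` is not a forest. If
it is one, the frontier is thus within bounded distance of all of `S` (`exists_frontier_near`). As
walks are determined by their start and labels, the number of 2-cells is at most a constant times
the size of the frontier (`card_le_mul_card_frontier`). -/

namespace PartialTorus

/-! ### Cores, rays and embedded circles in a graph. -/

namespace MGraph

variable {G : MGraph.{u}}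

lemma rev_rev (d : G.Dart) : rev (rev d) = d := by
  rcases d with ⟨e, _ | _⟩ <;> rfl

lemma rev_ne_self (d : G.Dart) : rev d ≠ d := by
  rcases d with ⟨e, _ | _⟩ <;> simp [rev]

lemma eq_or_eq_rev {d d' : G.Dart} (h : d.1 = d'.1) : d = d' ∨ d = rev d' := by
  rcases d with ⟨e, _ | _⟩ <;> rcases d' with ⟨e', _ | _⟩ <;> simp_all [rev]

lemma mem_revPath {l : List G.Dart} {d : G.Dart} : d ∈ revPath l ↔ rev d ∈ l := by
  simp only [revPath, List.mem_reverse, List.mem_map]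
  constructor
  · rintro ⟨a, ha, rfl⟩
    rwa [rev_rev]
  · exact fun h => ⟨_, h, rev_rev d⟩

lemma revPath_revPath (l : List G.Dart) : revPath (revPath l) = l := by
  simp [revPath, List.map_reverse, Function.comp_def, rev_rev]

lemma isChain_revPath {l : List G.Dart} (h : l.IsChain (fun a b => b ≠ rev a)) :
    (revPath l).IsChain (fun a b => b ≠ rev a) := by
  rw [revPath, List.isChain_reverse, List.isChain_map]
  refine h.imp fun a b hab hba => hab ?_
  simpa [rev_rev] using hba.symm

/-- A set of edges is a core if no vertex is the endpoint of exactly one of its half-edges. -/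
def IsCore (A : Set G.E) : Prop :=
  ∀ d : G.Dart, d.1 ∈ A → ∃ d' : G.Dart, d'.1 ∈ A ∧ src d' = src d ∧ d' ≠ d

/-- An infinite edge path without backtracking. -/
def IsRay (p : ℕ → G.Dart) : Prop :=
  ∀ i, src (p (i + 1)) = tgt (p i) ∧ p (i + 1) ≠ rev (p i)

lemma IsCore.exists_ray {A : Set G.E} (hA : IsCore A) {d : G.Dart} (hd : d.1 ∈ A) :
    ∃ p : ℕ → G.Dart, IsRay p ∧ p 0 = d ∧ ∀ i, (p i).1 ∈ A := by
  have step : ∀ x : {x : G.Dart // x.1 ∈ A}, ∃ y : {x : G.Dart // x.1 ∈ A},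
      src y.1 = tgt x.1 ∧ y.1 ≠ rev x.1 := by
    rintro ⟨x, hx⟩
    obtain ⟨y, hy, h1, h2⟩ := hA (rev x) hx
    exact ⟨⟨y, hy⟩, by rw [h1, src_rev], h2⟩
  choose f hf using step
  refine ⟨fun i => (f^[i] ⟨d, hd⟩).1, fun i => ?_, rfl, fun i => (f^[i] ⟨d, hd⟩).2⟩
  simp only [Function.iterate_succ_apply']
  exact hf _

lemma IsRay.isPath {p : ℕ → G.Dart} (hp : IsRay p) (i k : ℕ) :
    IsPath (src (p i)) ((List.range k).map fun j => p (i + j)) (src (p (i + k))) := by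
  induction k with
  | zero => rfl
  | succ k ih =>
    rw [List.range_succ, List.map_append]
    exact isPath_append.2 ⟨_, ih, rfl, ((hp (i + k)).1).symm⟩

/-- The circle closes up at the first repeated vertex. Before that, an edge traversed twice would
either repeat a vertex or be an immediate backtrack. The bound on the indices matters later, when
only an initial segment of the ray is under control. -/
lemma IsRay.exists_isEmbeddedCircle [Finite G.V] {p : ℕ → G.Dart} (hp : IsRay p) :
    ∃ l, IsEmbeddedCircle l ∧ ∀ d ∈ l, ∃ i < Nat.card G.V, p i = d := by
  classical
  have hex : ∃ j, j ≤ Nat.card G.V ∧ ∃ i < j, src (p i) = src (p j) := by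
    have : ¬ Function.Injective fun i : Fin (Nat.card G.V + 1) => src (p i) := fun h => by
      have := Nat.card_le_card_of_injective _ h
      simp at this
    simp only [Function.Injective, not_forall] at this
    obtain ⟨a, b, hab, hne⟩ := this
    rcases lt_or_gt_of_ne hne with h | h
    · exact ⟨b, by omega, a, h, hab⟩
    · exact ⟨a, by omega, b, h, hab.symm⟩
  obtain ⟨hj, i, hij, hsrc⟩ := Nat.find_spec hex
  have hmin := fun m => Nat.find_min hex (m := m)
  generalize Nat.find hex = j at *
  have hlt : ∀ a b, a < b → b < j → src (p a) ≠ src (p b) := fun a b hab hbj h =>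
    hmin b hbj ⟨by omega, a, hab, h⟩
  refine ⟨(List.range (j - i)).map fun k => p (i + k), ⟨?_, ⟨src (p i), ?_⟩, ?_, ?_⟩, ?_⟩
  · simp; omega
  · have := hp.isPath i (j - i)
    rwa [show i + (j - i) = j by omega, ← hsrc] at this
  · rw [List.map_map]
    refine List.Nodup.map_on (fun a ha b hb hab => ?_) List.nodup_range
    simp only [List.mem_range, Function.comp] at ha hb hab
    rcases lt_trichotomy a b with h | h | h
    · exact absurd hab (hlt _ _ (by omega) (by omega))
    · exact h
    · exact absurd hab.symm (hlt _ _ (by omega) (by omega))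
  · have key : ∀ a b, a < b → b < j → (p a).1 ≠ (p b).1 := fun a b hab hbj h => by
      rcases eq_or_eq_rev h.symm with h | h
      · exact hlt a b hab hbj (by rw [h])
      · have h1 : src (p b) = src (p (a + 1)) := by rw [h, src_rev, (hp a).1]
        rcases Nat.lt_or_ge (a + 1) b with h2 | h2
        · exact hlt _ _ h2 hbj h1.symm
        · obtain rfl : b = a + 1 := by omega
          exact (hp a).2 h
    rw [List.map_map]
    refine List.Nodup.map_on (fun a ha b hb hab => ?_) List.nodup_range
    simp only [List.mem_range, Function.comp] at ha hb hab
    rcases lt_trichotomy a b with h | h | h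
    · exact absurd hab (key _ _ (by omega) (by omega))
    · exact h
    · exact absurd hab.symm (key _ _ (by omega) (by omega))
  · simp only [List.mem_map, List.mem_range]
    rintro d ⟨a, ha, rfl⟩
    exact ⟨i + a, by omega, rfl⟩

lemma IsEmbeddedCircle.isCore {l : List G.Dart} (hl : IsEmbeddedCircle l) :
    IsCore {e | ∃ d ∈ l, d.1 = e} := by
  obtain ⟨hne, ⟨x, hx⟩, -, hE⟩ := hl
  have hpos : 0 < l.length := List.length_pos_iff.2 hne
  -- The case `i = j` is included, so a circle consisting of a single loop needs no separate
  -- treatment.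
  have inj : ∀ (i j : ℕ) (hi : i < l.length) (hj : j < l.length), l[j] = rev l[i] → False := by
    intro i j hi hj h
    have h1 : (l.map Prod.fst)[i]'(by simpa) = (l.map Prod.fst)[j]'(by simpa) := by
      simp [h, rev]
    have : i = j := (List.Nodup.getElem_inj_iff hE).1 h1
    subst this
    exact rev_ne_self _ h.symm
  have next : ∀ d ∈ l, ∃ d' ∈ l, src d' = tgt d ∧ d' ≠ rev d := by
    intro d hd
    obtain ⟨i, hi, rfl⟩ := List.getElem_of_mem hd
    rcases Nat.lt_or_ge (i + 1) l.length with h | h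
    · exact ⟨l[i + 1], List.getElem_mem _, hx.src_getElem_succ i h, inj _ _ _ _⟩
    · refine ⟨l[0], List.getElem_mem _, ?_, inj _ _ _ _⟩
      rw [hx.src_getElem_zero hpos, hx.tgt_getElem_last i (by omega)]
  have prev : ∀ d ∈ l, ∃ d' ∈ l, tgt d' = src d ∧ rev d' ≠ d := by
    intro d hd
    obtain ⟨i, hi, rfl⟩ := List.getElem_of_mem hd
    cases i with
    | succ i =>
      exact ⟨l[i], List.getElem_mem _, (hx.src_getElem_succ i hi).symm, fun h => inj _ _ _ _ h.symm⟩
    | zero =>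
      refine ⟨l[l.length - 1], List.getElem_mem _, ?_, fun h => inj _ _ _ _ h.symm⟩
      rw [hx.src_getElem_zero hpos, hx.tgt_getElem_last _ (by omega)]
  rintro d ⟨d₀, hd₀, h⟩
  rcases eq_or_eq_rev h.symm with rfl | rfl
  · obtain ⟨d', h1, h2, h3⟩ := prev d hd₀
    exact ⟨rev d', ⟨d', h1, rfl⟩, by rw [src_rev, h2], h3⟩
  · obtain ⟨d', h1, h2, h3⟩ := next d₀ hd₀
    exact ⟨d', ⟨d', h1, rfl⟩, by rw [src_rev, h2], h3⟩

lemma not_isForest_iff_exists_isCore [Finite G.V] :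
    ¬ G.IsForest ↔ ∃ A : Set G.E, A.Nonempty ∧ IsCore A := by
  simp only [IsForest, not_forall, not_not]
  constructor
  · rintro ⟨l, hl⟩
    obtain ⟨d, hd⟩ := List.exists_mem_of_ne_nil l hl.1
    exact ⟨{e | ∃ d ∈ l, d.1 = e}, ⟨d.1, d, hd, rfl⟩, hl.isCore⟩
  · rintro ⟨A, ⟨e, he⟩, hA⟩
    obtain ⟨p, hp, -⟩ := hA.exists_ray (d := (e, true)) he
    obtain ⟨l, hl, -⟩ := hp.exists_isEmbeddedCircle
    exact ⟨l, hl⟩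

end MGraph

open MGraph

/-! ### Images of cores under immersions. -/

namespace CellularMap

variable {G F : MGraph.{u}}

lemma fst_mem_of_mem_dartMap (φ : CellularMap G F) {D : G.Dart} {d : F.Dart}
    (h : d ∈ φ.dartMap D) : ∃ d' ∈ φ.emap D.1, d'.1 = d.1 := by
  rcases D with ⟨e, _ | _⟩
  · exact ⟨rev d, by simpa [dartMap, mem_revPath] using h, rfl⟩
  · exact ⟨d, by simpa [dartMap] using h, rfl⟩

lemma exists_mem_dartMap (φ : CellularMap G F) {a : G.E} {d d' : F.Dart}
    (h : d' ∈ φ.emap a) (hd : d'.1 = d.1) : ∃ D : G.Dart, D.1 = a ∧ d ∈ φ.dartMap D := by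
  rcases eq_or_eq_rev hd with rfl | rfl
  · exact ⟨(a, true), rfl, by simpa [dartMap] using h⟩
  · exact ⟨(a, false), rfl, by simpa [dartMap, mem_revPath] using h⟩

lemma IsImmersion.isChain_dartMap {φ : CellularMap G F} (hφ : φ.IsImmersion) (D : G.Dart) :
    (φ.dartMap D).IsChain (fun a b => b ≠ rev a) := by
  rcases D with ⟨e, _ | _⟩
  · simpa [dartMap] using isChain_revPath (hφ.reduced e)
  · simpa [dartMap] using hφ.reduced e

/-- The edges traversed by the image of a set of edges. -/
def edgeImage (φ : CellularMap G F) (A : Set G.E) : Set F.E :=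
  {e | ∃ a ∈ A, ∃ d ∈ φ.emap a, d.1 = e}

/-- A half-edge in the interior of an image path has the reverse of its predecessor as a companion,
distinct because the path is reduced. A half-edge that begins an image path gets its companion from
a second half-edge of `A` at the same vertex, by local injectivity. -/
lemma IsImmersion.isCore_edgeImage {φ : CellularMap G F} (hφ : φ.IsImmersion) {A : Set G.E}
    (hA : IsCore A) : IsCore (φ.edgeImage A) := by
  rintro d ⟨a, ha, d₀, hd₀, h⟩
  obtain ⟨D, rfl, hD⟩ := φ.exists_mem_dartMap hd₀ h
  have mem : ∀ D : G.Dart, D.1 ∈ A → ∀ x ∈ φ.dartMap D, x.1 ∈ φ.edgeImage A := by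
    intro D hD x hx
    obtain ⟨d', h1, h2⟩ := φ.fst_mem_of_mem_dartMap hx
    exact ⟨_, hD, d', h1, h2⟩
  obtain ⟨l₁, l₂, hl⟩ := List.append_of_mem hD
  have hpath := φ.isPath_dartMap D
  have hchain := hφ.isChain_dartMap D
  rcases List.eq_nil_or_concat l₁ with rfl | ⟨l, x, rfl⟩
  · obtain ⟨D', hD', h1, h2⟩ := hA D ha
    obtain ⟨x, m, hm⟩ := List.exists_cons_of_ne_nil (φ.dartMap_ne_nil D')
    have hpath' := φ.isPath_dartMap D'
    rw [hm, h1] at hpath'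
    rw [hl] at hpath
    refine ⟨x, mem D' hD' x (by simp [hm]), hpath'.1.trans hpath.1.symm, ?_⟩
    rintro rfl
    exact h2 (hφ.injective_at_vertex _ _ h1 (by simp [hl, hm]))
  · rw [hl] at hpath hchain
    simp only [List.concat_eq_append, List.append_assoc, List.cons_append, List.nil_append]
      at hl hpath hchain
    obtain ⟨z, -, h1, h2, -⟩ := isPath_append.1 hpath
    refine ⟨rev x, mem D ha x (by simp [hl]), by rw [src_rev, h2], fun h => ?_⟩
    have := (List.isChain_append.1 hchain).2.1
    rw [List.isChain_cons_cons] at this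
    exact this.1 h.symm

end CellularMap

/-! ### Cores in subdivisions. -/

namespace CellularMap

variable {G F : MGraph.{u}}

lemma length_pos (φ : CellularMap G F) (e : G.E) : 0 < (φ.emap e).length :=
  List.length_pos_iff.2 (φ.ne_nil e)

/-- The half-edge of the subdivision that a half-edge of `G` starts with. -/
def firstDart (φ : CellularMap G F) (d : G.Dart) : φ.subdivision.Dart :=
  if d.2 then (⟨d.1, ⟨0, φ.length_pos d.1⟩⟩, true)
  else (⟨d.1, ⟨(φ.emap d.1).length - 1, by have := φ.length_pos d.1; omega⟩⟩, false)

lemma fst_firstDart (φ : CellularMap G F) (d : G.Dart) : (φ.firstDart d).1.1 = d.1 := by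
  rcases d with ⟨e, _ | _⟩ <;> rfl

lemma src_firstDart (φ : CellularMap G F) (d : G.Dart) :
    src (φ.firstDart d) = Sum.inl (src d) := by
  have := φ.length_pos d.1
  rcases d with ⟨e, _ | _⟩
  · change φ.subdivision.ter _ = _
    exact dif_pos (Nat.sub_add_cancel this)
  · rfl

lemma snd_firstDart (φ : CellularMap G F) (d : G.Dart) : (φ.firstDart d).2 = d.2 := by
  rcases d with ⟨e, _ | _⟩ <;> rfl

lemma firstDart_injective (φ : CellularMap G F) : Function.Injective φ.firstDart := by
  intro d d' h
  refine Prod.ext ?_ ?_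
  · rw [← fst_firstDart, h, fst_firstDart]
  · rw [← snd_firstDart, h, snd_firstDart]

lemma src_interior_fst (φ : CellularMap G F) (e : G.E) (k : ℕ) (h : k + 1 < (φ.emap e).length) :
    src (G := φ.subdivision) (⟨e, ⟨k, by omega⟩⟩, false) = Sum.inr ⟨e, ⟨k, by omega⟩⟩ := by
  change φ.subdivision.ter _ = _
  exact dif_neg h.ne

lemma src_interior_snd (φ : CellularMap G F) (e : G.E) (k : ℕ) (h : k + 1 < (φ.emap e).length) :
    src (G := φ.subdivision) (⟨e, ⟨k + 1, h⟩⟩, true) = Sum.inr ⟨e, ⟨k, by omega⟩⟩ := rfl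

lemma dart_cases (φ : CellularMap G F) (s : φ.subdivision.Dart) :
    (∃ d, d.1 = s.1.1 ∧ s = φ.firstDart d) ∨
    ∃ (e : G.E) (k : ℕ) (h : k + 1 < (φ.emap e).length),
      src s = Sum.inr ⟨e, ⟨k, by omega⟩⟩ ∧
      (s = (⟨e, ⟨k, by omega⟩⟩, false) ∨ s = (⟨e, ⟨k + 1, h⟩⟩, true)) := by
  rcases s with ⟨⟨e, ⟨j, hj⟩⟩, _ | _⟩
  · by_cases h : j + 1 = (φ.emap e).length
    · left
      refine ⟨(e, false), rfl, ?_⟩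
      have : j = (φ.emap e).length - 1 := by omega
      subst this
      rfl
    · right
      exact ⟨e, j, by omega, src_interior_fst _ _ _ (by omega), Or.inl rfl⟩
  · cases j with
    | zero => exact Or.inl ⟨(e, true), rfl, rfl⟩
    | succ j => exact Or.inr ⟨e, j, hj, src_interior_snd _ _ _ hj, Or.inr rfl⟩

lemma isCore_subdivision (φ : CellularMap G F) {A : Set G.E} (hA : IsCore A) :
    IsCore (G := φ.subdivision) {s | s.1 ∈ A} := by
  intro s hs
  rcases φ.dart_cases s with ⟨d, h1, rfl⟩ | ⟨e, k, h, -, rfl | rfl⟩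
  · obtain ⟨d', h2, h3, h4⟩ := hA d (h1 ▸ hs)
    refine ⟨φ.firstDart d', ?_, ?_, fun h => h4 (φ.firstDart_injective h)⟩
    · rw [Set.mem_ofPred_eq, fst_firstDart]
      exact h2
    · rw [src_firstDart, src_firstDart, h3]
  · exact ⟨(⟨e, ⟨k + 1, h⟩⟩, true), hs, by
      rw [src_interior_fst _ _ _ h, src_interior_snd _ _ _ h], fun h => by cases congrArg Prod.snd h⟩
  · exact ⟨(⟨e, ⟨k, by omega⟩⟩, false), hs, by
      rw [src_interior_fst _ _ _ h, src_interior_snd _ _ _ h], fun h => by cases congrArg Prod.snd h⟩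

/-- The subdividing vertices have valence two, so a core containing one piece of an edge contains
the adjacent pieces. -/
lemma mem_of_isCore_subdivision (φ : CellularMap G F) {B : Set φ.subdivision.E}
    (hB : IsCore B) {e : G.E} {j : Fin (φ.emap e).length} (hj : (⟨e, j⟩ : φ.subdivision.E) ∈ B)
    (j' : Fin (φ.emap e).length) : (⟨e, j'⟩ : φ.subdivision.E) ∈ B := by
  have other : ∀ (k : ℕ) (h : k + 1 < (φ.emap e).length) (s : φ.subdivision.Dart),
      src s = Sum.inr ⟨e, ⟨k, by omega⟩⟩ →
      s = (⟨e, ⟨k, by omega⟩⟩, false) ∨ s = (⟨e, ⟨k + 1, h⟩⟩, true) := by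
    intro k h s hs
    rcases φ.dart_cases s with ⟨d, -, rfl⟩ | ⟨e', k', h', h1, h2⟩
    · rw [src_firstDart] at hs
      cases hs
    · rw [h1] at hs
      have hs := Sum.inr.inj hs
      obtain rfl : e' = e := congrArg Sigma.fst hs
      obtain rfl : k' = k := congrArg Fin.val (eq_of_heq (Sigma.mk.inj hs).2)
      exact h2
  have step : ∀ (k : ℕ) (h : k + 1 < (φ.emap e).length),
      ((⟨e, ⟨k, by omega⟩⟩ : φ.subdivision.E) ∈ B ↔ (⟨e, ⟨k + 1, h⟩⟩ : φ.subdivision.E) ∈ B) := by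
    intro k h
    constructor
    · intro hk
      obtain ⟨s, h1, h2, h3⟩ := hB (⟨e, ⟨k, by omega⟩⟩, false) hk
      rw [src_interior_fst _ _ _ h] at h2
      rcases other k h s h2 with rfl | rfl
      · exact absurd rfl h3
      · exact h1
    · intro hk
      obtain ⟨s, h1, h2, h3⟩ := hB (⟨e, ⟨k + 1, h⟩⟩, true) hk
      rw [src_interior_snd _ _ _ h] at h2
      rcases other k h s h2 with rfl | rfl
      · exact h1
      · exact absurd rfl h3
  have all : ∀ (k : ℕ) (h : k < (φ.emap e).length), ((⟨e, ⟨k, h⟩⟩ : φ.subdivision.E) ∈ B ↔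
      (⟨e, ⟨0, φ.length_pos e⟩⟩ : φ.subdivision.E) ∈ B) := by
    intro k
    induction k with
    | zero => exact fun h => Iff.rfl
    | succ k ih => exact fun h => (step k h).symm.trans (ih (by omega))
  exact (all j' j'.2).2 ((all j j.2).1 hj)

lemma isCore_of_subdivision (φ : CellularMap G F) {B : Set φ.subdivision.E} (hB : IsCore B) :
    IsCore {e : G.E | ∃ j, (⟨e, j⟩ : φ.subdivision.E) ∈ B} := by
  rintro d ⟨j, hj⟩
  have hd : (φ.firstDart d).1 ∈ B := by
    rcases d with ⟨e, _ | _⟩ <;> exact φ.mem_of_isCore_subdivision hB hj _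
  obtain ⟨s, h1, h2, h3⟩ := hB _ hd
  rw [src_firstDart] at h2
  rcases φ.dart_cases s with ⟨d', -, rfl⟩ | ⟨e', k', h', h4, -⟩
  · refine ⟨d', ?_, ?_, fun h => h3 (h ▸ rfl)⟩
    · rcases d' with ⟨e, _ | _⟩ <;> exact ⟨_, h1⟩
    · rw [src_firstDart] at h2
      exact Sum.inl.inj h2
  · rw [h4] at h2
    cases h2

instance finite_subdivision_V [Finite G.V] [Finite G.E] (φ : CellularMap G F) :
    Finite φ.subdivision.V := by
  unfold subdivision; infer_instance

instance finite_subdivision_E [Finite G.E] (φ : CellularMap G F) :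
    Finite φ.subdivision.E := by
  unfold subdivision; infer_instance

/-! ### Surviving edges and invariant cores. -/

variable {H : Subgraph F}

/-- `ψ.Survives n e`: the maps `ψ⁰, …, ψⁿ` send the edge `e` into `H`. -/
def Survives (ψ : CellularMap H.toGraph F) : ℕ → F.E → Prop
  | 0, e => e ∈ H.edges
  | n + 1, e => ∃ h : e ∈ H.edges, ∀ d ∈ ψ.emap ⟨e, h⟩, Survives ψ n d.1

lemma Survives.mem {ψ : CellularMap H.toGraph F} {n : ℕ} {e : F.E} (h : ψ.Survives n e) :
    e ∈ H.edges := by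
  cases n with
  | zero => exact h
  | succ n => exact h.1

lemma Survives.of_succ {ψ : CellularMap H.toGraph F} {n : ℕ} {e : F.E}
    (h : ψ.Survives (n + 1) e) : ψ.Survives n e := by
  induction n generalizing e with
  | zero => exact h.1
  | succ n ih => exact ⟨h.1, fun d hd => ih (h.2 d hd)⟩

lemma Survives.mono {ψ : CellularMap H.toGraph F} {m n : ℕ} (hmn : m ≤ n) {e : F.E}
    (h : ψ.Survives n e) : ψ.Survives m e := by
  induction n, hmn using Nat.le_induction with
  | base => exact h
  | succ n _ ih => exact ih h.of_succ

/-- The graph over `F` contains a non-empty core whose image survives `n` steps. -/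
def HasSurvivingCore (ψ : CellularMap H.toGraph F) (P : GraphOver F) (n : ℕ) : Prop :=
  ∃ A : Set P.graph.E, A.Nonempty ∧ IsCore A ∧ ∀ a ∈ A, ψ.Survives n (P.emap a).1

lemma isCore_coe_iff {G : MGraph.{u}} {K : Subgraph G} {A : Set K.toGraph.E} :
    IsCore A ↔ IsCore (Subtype.val '' A : Set G.E) := by
  have hsrc : ∀ d : K.toGraph.Dart, (src d).1 = src ((d.1.1, d.2) : G.Dart) := by
    rintro ⟨e, _ | _⟩ <;> rfl
  constructor
  · rintro hA ⟨_, b⟩ ⟨e, he, rfl⟩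
    obtain ⟨d', h1, h2, h3⟩ := hA (e, b) he
    refine ⟨(d'.1.1, d'.2), ⟨d'.1, h1, rfl⟩, ?_, fun h => h3 ?_⟩
    · rw [← hsrc, h2, hsrc]
    · exact Prod.ext (Subtype.ext (congrArg Prod.fst h)) (congrArg Prod.snd h :)
  · rintro hA ⟨e, b⟩ he
    obtain ⟨⟨_, b'⟩, ⟨e', h1, rfl⟩, h2, h3⟩ := hA (e.1, b) ⟨e, he, rfl⟩
    refine ⟨(e', b'), h1, Subtype.ext ?_, fun h => h3 ?_⟩
    · rw [hsrc, hsrc, ← h2]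
    · exact Prod.ext (congrArg (fun d => d.1.1) h) (congrArg Prod.snd h :)

lemma isCore_toGraph {G : MGraph.{u}} {K : Subgraph G} {A : Set G.E} (hA : IsCore A)
    (hK : A ⊆ K.edges) : IsCore (G := K.toGraph) {a | a.1 ∈ A} := by
  rw [isCore_coe_iff]
  convert hA
  ext x
  constructor
  · rintro ⟨y, hy, rfl⟩
    exact hy
  · exact fun hx => ⟨⟨x, hK hx⟩, hx, rfl⟩

/-- This trades one step of survival for one more composition with `ψ`; iterating it moves all the
information from the subdivided domain of `ψⁿ` back to `F`. -/
lemma hasSurvivingCore_succ_iff (ψ : CellularMap H.toGraph F) (P : GraphOver F) (n : ℕ) :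
    ψ.HasSurvivingCore P (n + 1) ↔
      ψ.HasSurvivingCore (GraphOver.ofCellularMap (P.comp ψ)) n := by
  constructor
  · rintro ⟨A, ⟨a, ha⟩, hA, hs⟩
    have hsub : ∀ a ∈ A, a ∈ (P.preimage H).edges := fun a ha => (hs a ha).mem
    refine ⟨{s | s.1.1 ∈ A}, ⟨⟨⟨a, hsub a ha⟩, ⟨0, (P.comp ψ).length_pos _⟩⟩, ha⟩,
      (P.comp ψ).isCore_subdivision (isCore_toGraph hA hsub), ?_⟩
    rintro ⟨b, j⟩ hb
    obtain ⟨h, h'⟩ := hs b.1 hb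
    obtain ⟨d', hd', h1⟩ := ψ.fst_mem_of_mem_dartMap
      (List.getElem_mem (l := ψ.dartMap (⟨(P.emap b.1).1, b.2⟩, (P.emap b.1).2)) j.2)
    have := h' d' hd'
    rw [h1] at this
    exact this
  · rintro ⟨B, ⟨⟨a, j⟩, ha⟩, hB, hs⟩
    refine ⟨Subtype.val '' {e : (P.preimage H).toGraph.E | ∃ j, (⟨e, j⟩ :
      (P.comp ψ).subdivision.E) ∈ B}, ⟨a.1, a, ⟨j, ha⟩, rfl⟩,
      isCore_coe_iff.1 ((P.comp ψ).isCore_of_subdivision hB), ?_⟩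
    rintro _ ⟨b, ⟨j, hj⟩, rfl⟩
    refine ⟨b.2, fun d hd => ?_⟩
    obtain ⟨d', hd', h1⟩ : ∃ d' ∈ (P.comp ψ).emap b, d'.1 = d.1 := by
      change ∃ d' ∈ ψ.dartMap _, _
      unfold dartMap
      split_ifs
      · exact ⟨d, hd, rfl⟩
      · exact ⟨rev d, by rw [mem_revPath, rev_rev]; exact hd, rfl⟩
    obtain ⟨k, hk, rfl⟩ := List.getElem_of_mem hd'
    have := hs _ ((P.comp ψ).mem_of_isCore_subdivision hB hj ⟨k, hk⟩)
    rw [← h1]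
    exact this

lemma hasSurvivingCore_iterate_iff (ψ : CellularMap H.toGraph F) (m n : ℕ) :
    ψ.HasSurvivingCore (ψ.iterate m) n ↔ ψ.HasSurvivingCore (ψ.iterate (m + n)) 0 := by
  induction n generalizing m with
  | zero => rfl
  | succ n ih =>
    rw [hasSurvivingCore_succ_iff, show m + (n + 1) = m + 1 + n by omega, ← ih (m + 1)]
    rfl

lemma finite_iterate [Finite F.V] [Finite F.E] (ψ : CellularMap H.toGraph F) (n : ℕ) :
    Finite (ψ.iterate n).graph.V ∧ Finite (ψ.iterate n).graph.E := by
  induction n with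
  | zero => exact ⟨‹_›, ‹_›⟩
  | succ n ih =>
    obtain ⟨h1, h2⟩ := ih
    have h3 : Finite ((ψ.iterate n).preimage H).toGraph.V := Subtype.finite
    have h4 : Finite ((ψ.iterate n).preimage H).toGraph.E := Subtype.finite
    exact ⟨finite_subdivision_V ((ψ.iterate n).comp ψ),
      finite_subdivision_E ((ψ.iterate n).comp ψ)⟩

lemma not_isForest_iteratedPreimage_iff [Finite F.V] [Finite F.E] (ψ : CellularMap H.toGraph F)
    (n : ℕ) : ¬ (ψ.iteratedPreimage n).IsForest ↔
      ∃ A : Set F.E, A.Nonempty ∧ IsCore A ∧ ∀ e ∈ A, ψ.Survives n e := by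
  have hfin := (ψ.finite_iterate n).1
  have : Finite (ψ.iteratedPreimage n).V := Subtype.finite
  have h := ψ.hasSurvivingCore_iterate_iff 0 n
  rw [Nat.zero_add] at h
  rw [not_isForest_iff_exists_isCore]
  refine Iff.trans ?_ h.symm
  constructor
  · rintro ⟨A, hne, hA⟩
    refine ⟨Subtype.val '' A, hne.image _, isCore_coe_iff.1 hA, ?_⟩
    rintro _ ⟨a, -, rfl⟩
    exact a.2
  · rintro ⟨A, ⟨a, ha⟩, hA, hs⟩
    exact ⟨{a | a.1 ∈ A}, ⟨⟨a, hs a ha⟩, ha⟩, isCore_toGraph hA hs⟩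

/-- The invariant cores: non-empty cores in `H` that `ψ` maps into themselves. -/
def IsInvariantCore (ψ : CellularMap H.toGraph F) (A : Set F.E) : Prop :=
  A.Nonempty ∧ IsCore A ∧ ∀ e ∈ A, ∃ h : e ∈ H.edges, ∀ d ∈ ψ.emap ⟨e, h⟩, d.1 ∈ A

/-- `F` has finitely many edge sets, so one of them is a surviving core for infinitely many `n`,
hence for all `n`. -/
lemma exists_isInvariantCore [Finite F.V] [Finite F.E] {ψ : CellularMap H.toGraph F}
    (hψ : ψ.IsImmersion) (h : ∀ n, ¬ (ψ.iteratedPreimage n).IsForest) :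
    ∃ A, ψ.IsInvariantCore A := by
  simp only [not_isForest_iteratedPreimage_iff] at h
  choose A hne hA hs using h
  obtain ⟨B, hB⟩ := Finite.exists_infinite_fiber A
  have hinf : Set.Infinite (A ⁻¹' {B}) := Set.infinite_coe_iff.1 hB
  have hsurv : ∀ e ∈ B, ∀ n, ψ.Survives n e := by
    intro e he n
    obtain ⟨m, hm, hnm⟩ := hinf.exists_gt n
    exact (hs m e (by rwa [show A m = B from hm])).mono hnm.le
  obtain ⟨m, hm⟩ := hinf.nonempty
  have hm : A m = B := hm
  -- A single such core need not be mapped into itself, but its image is again a core that survives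
  -- forever. So the union of all of them is invariant.
  refine ⟨⋃₀ {C | IsCore C ∧ ∀ e ∈ C, ∀ n, ψ.Survives n e}, ?_, ?_, ?_⟩
  · obtain ⟨e, he⟩ := hne m
    exact ⟨e, A m, ⟨hA m, hm ▸ hsurv⟩, he⟩
  · rintro d ⟨C, hC, hd⟩
    obtain ⟨d', h1, h2⟩ := hC.1 d hd
    exact ⟨d', ⟨C, hC, h1⟩, h2⟩
  · rintro e ⟨C, ⟨hC, hCs⟩, he⟩
    refine ⟨(hCs e he 0).mem, fun d hd => ?_⟩
    refine ⟨ψ.edgeImage {a | a.1 ∈ C}, ⟨hψ.isCore_edgeImage (isCore_toGraph hC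
      fun a ha => (hCs a ha 0).mem), ?_⟩, ⟨_, he, d, hd, rfl⟩⟩
    · rintro _ ⟨a, ha, d, hd, rfl⟩ n
      exact (hCs a.1 ha (n + 1)).2 d hd

end CellularMap

namespace MGraph

lemma IsPath.toGraph {G : MGraph.{u}} {K : Subgraph G} {x y : K.verts} {l : List G.Dart}
    (h : IsPath x.1 l y.1) (hl : ∀ d ∈ l, d.1 ∈ K.edges) :
    IsPath (G := K.toGraph) x (l.pmap (fun d hd => (⟨d.1, hd⟩, d.2)) hl) y := by
  induction l generalizing x with
  | nil => exact Subtype.ext h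
  | cons d l ih =>
    have hd := hl d (by simp)
    refine ⟨Subtype.ext ?_, ih (x := tgt (G := K.toGraph) (⟨d.1, hd⟩, d.2)) ?_ _⟩
    · rw [← h.1]
      rcases d with ⟨e, _ | _⟩ <;> rfl
    · convert h.2
      rcases d with ⟨e, _ | _⟩ <;> rfl

end MGraph

/-! ### Subcomplexes and their free faces. -/

namespace TwoComplex

/-- A subcomplex: a subgraph of the `1`-skeleton and a set of `2`-cells attached to it. -/
structure Subcomplex (X : TwoComplex.{u}) where
  skel : Subgraph X.graph
  cells : Set X.C
  bdry_mem : ∀ c ∈ cells, ∀ d ∈ X.bdry c, d.1 ∈ skel.edges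

namespace Subcomplex

variable {X : TwoComplex.{u}}

/-- A subcomplex as a `2`-complex in its own right. -/
def toTwoComplex (K : Subcomplex X) : TwoComplex.{u} where
  graph := K.skel.toGraph
  C := K.cells
  bdry c := (X.bdry c).pmap (fun d hd => (⟨d.1, hd⟩, d.2)) (K.bdry_mem c c.2)
  bdry_ne_nil c := by
    simpa using X.bdry_ne_nil c
  bdry_closed c := by
    obtain ⟨x, hx⟩ := X.bdry_closed c
    have hxK : x ∈ K.skel.verts := by
      obtain ⟨d, l, hl⟩ := List.exists_cons_of_ne_nil (X.bdry_ne_nil c)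
      have hd := K.bdry_mem c c.2 d (by simp [hl])
      rw [hl] at hx
      rw [← hx.1]
      rcases d with ⟨e, _ | _⟩
      · exact K.skel.ter_mem e hd
      · exact K.skel.ini_mem e hd
    exact ⟨⟨x, hxK⟩, IsPath.toGraph (x := ⟨x, hxK⟩) (y := ⟨x, hxK⟩) hx _⟩

/-- The inclusion of a subcomplex. -/
def incl (K : Subcomplex X) : CombMap K.toTwoComplex X where
  vmap v := v.1
  emap e := e.1
  cmap c := c.1
  ini_emap _ := rfl
  ter_emap _ := rfl
  bdry_cmap c := by
    simp [toTwoComplex, List.map_pmap]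

lemma isImmersion_incl (K : Subcomplex X) : K.incl.IsImmersion where
  injective_on_darts _ _ _ h h' := Prod.ext (Subtype.ext h) h'
  injective_on_corners _ _ _ _ _ h _ := Subtype.ext h

lemma isFinite_toTwoComplex (hX : X.IsFinite) (K : Subcomplex X) : K.toTwoComplex.IsFinite := by
  obtain ⟨h1, h2, h3⟩ := hX
  exact ⟨Subtype.finite, Subtype.finite, Subtype.finite⟩

lemma not_isFreeEdge_and_not_isIsolatedEdge (K : Subcomplex X) (e : K.skel.edges) {c c' : X.C}
    (hc : c ∈ K.cells) (hc' : c' ∈ K.cells) {i i' : ℕ} (hi : i < (X.bdry c).length)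
    (hi' : i' < (X.bdry c').length) (h : (X.bdry c)[i].1 = e) (h' : (X.bdry c')[i'].1 = e)
    (hne : c = c' → i ≠ i') :
    ¬ K.toTwoComplex.IsFreeEdge e ∧ ¬ K.toTwoComplex.IsIsolatedEdge e := by
  have hl : ∀ c : K.cells, (K.toTwoComplex.bdry c).length = (X.bdry c).length := fun c => by
    simp [toTwoComplex]
  have hfst : ∀ (c : K.cells) (i : ℕ) (hi : i < (K.toTwoComplex.bdry c).length),
      ((K.toTwoComplex.bdry c)[i].1).1 = ((X.bdry c)[i]'(by rwa [hl c] at hi)).1 := by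
    intro c i hi
    simp [toTwoComplex]
  constructor
  · intro hfree
    have := hfree.unique
      (y₁ := ⟨⟨c, hc⟩, ⟨i, (hl ⟨c, hc⟩).symm ▸ hi⟩⟩)
      (y₂ := ⟨⟨c', hc'⟩, ⟨i', (hl ⟨c', hc'⟩).symm ▸ hi'⟩⟩)
      (Subtype.ext ((hfst _ _ _).trans h)) (Subtype.ext ((hfst _ _ _).trans h'))
    obtain ⟨h1, h2⟩ := Sigma.mk.inj this
    obtain rfl : c = c' := congrArg Subtype.val h1
    exact hne rfl (congrArg Fin.val (eq_of_heq h2))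
  · intro hiso
    refine hiso ⟨c, hc⟩ (List.mem_map.2 ⟨_, List.getElem_mem (n := i) ((hl ⟨c, hc⟩).symm ▸ hi), ?_⟩)
    exact Subtype.ext ((hfst _ _ _).trans h)

end Subcomplex

/-- A free vertex would be the endpoint of an isolated edge, so only edges need checking. -/
lemma isCollapsed_of {Y : TwoComplex.{u}}
    (h : ∀ e, ¬ Y.IsFreeEdge e ∧ ¬ Y.IsIsolatedEdge e) : Y.IsCollapsed := by
  refine ⟨fun e => (h e).1, ?_⟩
  rintro v ⟨⟨d, hd, -⟩, h2⟩
  exact (h d.1).2 (h2 d hd)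

end TwoComplex

/-! ### Horizontal height as an invariant of loops. -/

section Height

variable {F : MGraph.{u}} {H : Subgraph F} {ψ : CellularMap H.toGraph F}

/-- The signed number of horizontal edges in a list of half-edges of the mapping torus. -/
def torusHeight (ψ : CellularMap H.toGraph F) (l : List (torusGraph ψ).Dart) : ℤ :=
  (l.map fun d => Sum.elim (fun _ => 0) (fun _ => if d.2 then 1 else -1) d.1).sum

lemma torusHeight_append (l m : List (torusGraph ψ).Dart) :
    torusHeight ψ (l ++ m) = torusHeight ψ l + torusHeight ψ m := by
  simp [torusHeight]

lemma torusHeight_vertical (l : List F.Dart) : torusHeight ψ (l.map (vertical ψ)) = 0 := by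
  induction l with
  | nil => rfl
  | cons d l ih => simpa [torusHeight, vertical] using ih

lemma torusHeight_bdry (c : H.edges) : torusHeight ψ ((mappingTorus ψ).bdry c) = 0 := by
  have := torusHeight_vertical (ψ := ψ) (revPath (ψ.emap c))
  simp only [torusHeight] at this
  simp only [mappingTorus, torusHeight, List.map_cons, List.map_append, List.sum_cons,
    List.sum_append, this]
  rfl

/-- Height is a homotopy invariant: a backtrack contributes opposite signs, and each 2-cell of the
mapping torus has one horizontal edge in each direction. -/
lemma not_hasTrivialPi1_of_torusHeight {Y : TwoComplex.{u}}
    (f : TwoComplex.CombMap Y (mappingTorus ψ)) {v : Y.graph.V} {l : List Y.graph.Dart}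
    (hl : IsPath v l v) (h : torusHeight ψ (l.map fun d => (f.emap d.1, d.2)) ≠ 0) :
    ¬ Y.HasTrivialPi1 := by
  intro htriv
  have hsub := htriv v
  let φ : Y.Loop v → ℤ := fun l => torusHeight ψ (l.1.map fun d => (f.emap d.1, d.2))
  have hφ : ∀ a b, Y.HomotopyStep v a b → φ a = φ b := by
    intro a b hab
    obtain ⟨p, q, d, ha, hb⟩ | ⟨p, q, c, ha, hb⟩ := hab
    · simp only [φ, ha, hb, List.map_append, torusHeight_append]
      have : torusHeight ψ
          (([d, rev d] : List Y.graph.Dart).map fun d => (f.emap d.1, d.2)) = 0 := by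
        rcases d with ⟨e, b⟩
        rcases he : f.emap e with x | x <;> rcases b with _ | _ <;>
          simp [torusHeight, rev, he]
      rw [this]
      ring
    · simp only [φ, ha, hb, List.map_append, torusHeight_append]
      have : torusHeight ψ ((Y.bdry c).map fun d => (f.emap d.1, d.2)) = 0 :=
        (congrArg (torusHeight ψ) (f.bdry_cmap c)).symm.trans (torusHeight_bdry _)
      rw [this]
      ring
  have := congrArg (Quot.lift φ hφ)
    (hsub.elim (Quot.mk _ ⟨l, hl⟩) (Quot.mk _ ⟨[], rfl⟩))
  exact h this

end Height

/-! ### The mapping torus of a minimal invariant core. -/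

namespace MGraph

variable {G : MGraph.{u}}

/-- The endpoints of a set of edges. -/
def endpoints (A : Set G.E) : Set G.V := {v | ∃ d : G.Dart, d.1 ∈ A ∧ src d = v}

lemma src_mem_endpoints {A : Set G.E} {d : G.Dart} (hd : d.1 ∈ A) : src d ∈ endpoints A :=
  ⟨d, hd, rfl⟩

lemma tgt_mem_endpoints {A : Set G.E} {d : G.Dart} (hd : d.1 ∈ A) : tgt d ∈ endpoints A :=
  ⟨rev d, hd, src_rev d⟩

lemma Subgraph.src_mem (K : Subgraph G) {d : G.Dart} (hd : d.1 ∈ K.edges) : src d ∈ K.verts := by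
  rcases d with ⟨e, _ | _⟩
  · exact K.ter_mem e hd
  · exact K.ini_mem e hd

/-- Two vertices are joined by an edge path in a subgraph. -/
def Subgraph.Joined (K : Subgraph G) (x y : G.V) : Prop :=
  ∃ l : List G.Dart, IsPath x l y ∧ ∀ d ∈ l, d.1 ∈ K.edges

lemma Subgraph.Joined.trans {K : Subgraph G} {x y z : G.V} (h : K.Joined x y)
    (h' : K.Joined y z) : K.Joined x z := by
  obtain ⟨l, hl, hlK⟩ := h
  obtain ⟨m, hm, hmK⟩ := h'
  exact ⟨l ++ m, isPath_append.2 ⟨y, hl, hm⟩, fun d hd =>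
    (List.mem_append.1 hd).elim (hlK d) (hmK d)⟩

lemma Subgraph.Joined.symm {K : Subgraph G} {x y : G.V} (h : K.Joined x y) : K.Joined y x := by
  obtain ⟨l, hl, hlK⟩ := h
  exact ⟨revPath l, hl.revPath, fun d hd => hlK (rev d) (mem_revPath.1 hd)⟩

lemma Subgraph.joined_dart {K : Subgraph G} {d : G.Dart} (hd : d.1 ∈ K.edges) :
    K.Joined (src d) (tgt d) :=
  ⟨[d], ⟨rfl, rfl⟩, by simpa using hd⟩

end MGraph

namespace CellularMap

variable {F : MGraph.{u}} {H : Subgraph F} {ψ : CellularMap H.toGraph F} {A : Set F.E}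

lemma IsInvariantCore.mem (hA : ψ.IsInvariantCore A) {e : F.E} (he : e ∈ A) : e ∈ H.edges :=
  (hA.2.2 e he).1

lemma IsInvariantCore.emap_mem (hA : ψ.IsInvariantCore A) {e : H.toGraph.E} (he : e.1 ∈ A)
    {d : F.Dart} (hd : d ∈ ψ.emap e) : d.1 ∈ A :=
  (hA.2.2 e.1 he).2 d hd

lemma IsInvariantCore.edgeImage (hψ : ψ.IsImmersion) (hA : ψ.IsInvariantCore A) :
    ψ.IsInvariantCore (ψ.edgeImage {a | a.1 ∈ A}) := by
  refine ⟨?_, hψ.isCore_edgeImage (isCore_toGraph hA.2.1 fun _ => hA.mem), ?_⟩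
  · obtain ⟨e, he⟩ := hA.1
    obtain ⟨d, l, hl⟩ := List.exists_cons_of_ne_nil (ψ.ne_nil ⟨e, hA.mem he⟩)
    exact ⟨d.1, ⟨e, hA.mem he⟩, he, d, by simp [hl], rfl⟩
  · rintro _ ⟨a, ha, d, hd, rfl⟩
    have hd' : d.1 ∈ A := hA.emap_mem ha hd
    exact ⟨hA.mem hd', fun d₁ hd₁ => ⟨_, hd', d₁, hd₁, rfl⟩⟩

lemma IsInvariantCore.endpoints_subset (hA : ψ.IsInvariantCore A) : endpoints A ⊆ H.verts := by
  rintro _ ⟨d, hd, rfl⟩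
  exact H.src_mem (hA.mem hd)

lemma IsInvariantCore.vmap_mem (hA : ψ.IsInvariantCore A) {v : H.toGraph.V}
    (hv : v.1 ∈ endpoints A) : ψ.vmap v ∈ endpoints A := by
  obtain ⟨⟨e, b⟩, hd, hv⟩ := hv
  have hsrc : src (G := H.toGraph) (⟨e, hA.mem hd⟩, b) = v := by
    refine Subtype.ext ?_
    rw [← hv]
    cases b <;> rfl
  have hpath := ψ.isPath_dartMap (⟨e, hA.mem hd⟩, b)
  obtain ⟨x, l, hl⟩ := List.exists_cons_of_ne_nil (ψ.dartMap_ne_nil (⟨e, hA.mem hd⟩, b))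
  obtain ⟨y, hy, hyx⟩ := ψ.fst_mem_of_mem_dartMap
    (show x ∈ ψ.dartMap (⟨e, hA.mem hd⟩, b) by simp [hl])
  rw [hl, hsrc] at hpath
  refine ⟨x, ?_, hpath.1⟩
  rw [← hyx]
  exact hA.emap_mem (e := ⟨e, hA.mem hd⟩) hd hy

lemma mem_mappingTorus_bdry {e : H.edges} {d : (torusGraph ψ).Dart}
    (hd : d ∈ (mappingTorus ψ).bdry e) :
    d.1 = Sum.inl e.1 ∨ d.1 = Sum.inr (H.toGraph.ter e) ∨ d.1 = Sum.inr (H.toGraph.ini e) ∨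
      ∃ x ∈ ψ.emap e, d.1 = Sum.inl x.1 := by
  rcases List.mem_cons.1 hd with rfl | hd
  · exact Or.inl rfl
  rcases List.mem_cons.1 hd with rfl | hd
  · exact Or.inr (Or.inl rfl)
  rcases List.mem_append.1 hd with hd | hd
  · obtain ⟨x, hx, rfl⟩ := List.mem_map.1 hd
    exact Or.inr (Or.inr (Or.inr ⟨rev x, mem_revPath.1 hx, rfl⟩))
  · obtain rfl := List.mem_singleton.1 hd
    exact Or.inr (Or.inr (Or.inl rfl))

/-- The mapping torus of the restriction of `ψ` to an invariant core, as a subcomplex. -/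
def IsInvariantCore.subtorus (hA : ψ.IsInvariantCore A) : (mappingTorus ψ).Subcomplex where
  skel :=
    { verts := endpoints (G := F) A
      edges := {s | Sum.elim (fun e => e ∈ A) (fun v => v.1 ∈ endpoints A) s}
      ini_mem := by
        rintro (e | v) h
        · exact src_mem_endpoints (d := (e, true)) h
        · exact h
      ter_mem := by
        rintro (e | v) h
        · exact tgt_mem_endpoints (d := (e, true)) h
        · exact hA.vmap_mem h }
  cells := {e | e.1 ∈ A}
  bdry_mem := by
    intro e he d hd
    rcases mem_mappingTorus_bdry hd with h | h | h | ⟨x, hx, h⟩ <;> rw [h]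
    · exact he
    · exact tgt_mem_endpoints (d := (e.1, true)) he
    · exact src_mem_endpoints (d := (e.1, true)) he
    · exact hA.emap_mem he hx

lemma IsInvariantCore.joined_of_mem_emap (hA : ψ.IsInvariantCore A) {e : H.toGraph.E}
    (he : e.1 ∈ A) {d : F.Dart} (hd : d ∈ ψ.emap e) :
    hA.subtorus.skel.Joined (F.ini e.1) (src (G := F) d) := by
  obtain ⟨l₁, l₂, hl⟩ := List.append_of_mem hd
  have hpath := ψ.isPath e
  rw [hl] at hpath
  obtain ⟨z, h1, h2, -⟩ := isPath_append.1 hpath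
  refine ⟨(Sum.inr (H.toGraph.ini e), true) :: l₁.map (vertical ψ), ⟨rfl, ?_⟩, ?_⟩
  · rw [h2]
    exact IsPath.map_vertical ψ h1
  · intro x hx
    rcases List.mem_cons.1 hx with rfl | hx
    · exact src_mem_endpoints (d := (e.1, true)) he
    · obtain ⟨y, hy, rfl⟩ := List.mem_map.1 hx
      exact hA.emap_mem he (by rw [hl]; exact List.mem_append_left _ hy)

lemma IsInvariantCore.joined_vertical (hA : ψ.IsInvariantCore A) {d : F.Dart} (hd : d.1 ∈ A) :
    hA.subtorus.skel.Joined (src (G := F) d) (tgt (G := F) d) := by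
  rcases d with ⟨e, _ | _⟩
  · exact Subgraph.joined_dart (K := hA.subtorus.skel) (d := (Sum.inl e, false)) hd
  · exact Subgraph.joined_dart (K := hA.subtorus.skel) (d := (Sum.inl e, true)) hd

/-- The edges of `A` in the component of `x` form an invariant core themselves: a horizontal edge
joins each edge to its image. By minimality they are all of `A`. -/
lemma IsInvariantCore.joined_of_minimal (hA : Minimal ψ.IsInvariantCore A) {x y : F.V}
    (hx : x ∈ endpoints A) (hy : y ∈ endpoints A) : hA.1.subtorus.skel.Joined x y := by
  have hB : ψ.IsInvariantCore {e | e ∈ A ∧ hA.1.subtorus.skel.Joined x (F.ini e)} := by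
    have key : ∀ d : F.Dart, d.1 ∈ A → hA.1.subtorus.skel.Joined x (src (G := F) d) →
        hA.1.subtorus.skel.Joined x (F.ini d.1) := by
      rintro ⟨e, _ | _⟩ h1 h2
      · exact h2.trans (hA.1.joined_vertical (d := (e, false)) h1)
      · exact h2
    refine ⟨?_, ?_, ?_⟩
    · obtain ⟨d, hd, rfl⟩ := hx
      exact ⟨d.1, hd, key d hd ⟨[], rfl, by simp⟩⟩
    · rintro d ⟨h1, h2⟩
      obtain ⟨d', h3, h4, h5⟩ := hA.1.2.1 d h1
      refine ⟨d', ⟨h3, key d' h3 ?_⟩, h4, h5⟩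
      rw [h4]
      rcases d with ⟨e, _ | _⟩
      · exact h2.trans (hA.1.joined_vertical (d := (e, true)) h1)
      · exact h2
    · rintro e ⟨h1, h2⟩
      refine ⟨hA.1.mem h1, fun d hd => ?_⟩
      have hd' := hA.1.emap_mem (e := ⟨e, hA.1.mem h1⟩) h1 hd
      exact ⟨hd', key d hd' (h2.trans (hA.1.joined_of_mem_emap (e := ⟨e, hA.1.mem h1⟩) h1 hd))⟩
  obtain ⟨d, hd, rfl⟩ := hy
  have h := (hA.2 hB (fun e he => he.1) hd).2
  rcases d with ⟨e, _ | _⟩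
  · exact h.trans (hA.1.joined_vertical (d := (e, true)) hd)
  · exact h

lemma IsInvariantCore.connected_subtorus (hA : Minimal ψ.IsInvariantCore A) :
    hA.1.subtorus.toTwoComplex.graph.Connected := by
  constructor
  · obtain ⟨e, he⟩ := hA.1.1
    exact ⟨⟨F.ini e, src_mem_endpoints (G := F) (d := (e, true)) he⟩⟩
  · intro x y
    obtain ⟨l, hl, hlK⟩ := joined_of_minimal hA (x := x.1) (y := y.1) x.2 y.2
    exact ⟨_, IsPath.toGraph hl hlK⟩

/-- A vertical edge is the bottom of its own 2-cell and also lies in the top of some 2-cell, because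
minimality forces `ψ` to map `A` onto `A`. A horizontal edge at `v` is traversed once for each
half-edge of `A` at `v`, hence at least twice. -/
lemma IsInvariantCore.faces_subtorus (hψ : ψ.IsImmersion) (hA : Minimal ψ.IsInvariantCore A)
    (e : hA.1.subtorus.skel.edges) :
    ¬ hA.1.subtorus.toTwoComplex.IsFreeEdge e ∧
      ¬ hA.1.subtorus.toTwoComplex.IsIsolatedEdge e := by
  obtain ⟨e | v, he⟩ := e
  · have hsub : ψ.edgeImage {a | a.1 ∈ A} ⊆ A := by
      rintro _ ⟨a, ha, d, hd, rfl⟩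
      exact hA.1.emap_mem ha hd
    obtain ⟨a, ha, d, hd, hde⟩ := hA.2 (hA.1.edgeImage hψ) hsub he
    have hd' : rev d ∈ revPath (ψ.emap a) := by rwa [mem_revPath, rev_rev]
    obtain ⟨j, hj, hjd⟩ := List.getElem_of_mem hd'
    refine hA.1.subtorus.not_isFreeEdge_and_not_isIsolatedEdge ⟨Sum.inl e, he⟩
      (c := ⟨e, hA.1.mem he⟩) (c' := a) (i := 0) (i' := j + 2) he ha ?_ ?_ rfl ?_ (by simp)
    · simp [mappingTorus]
    · simp [mappingTorus]; omega
    · simp only [mappingTorus, List.getElem_cons_succ]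
      rw [List.getElem_append_left (by simpa using hj)]
      simp [vertical, hjd, rev, hde]
      rfl
  · obtain ⟨d, hd, hv⟩ := he
    have hvH : v.1 = src d := hv.symm
    -- In the attaching path, the horizontal edge at the end of `d.1` is at position 1 and the one
    -- at its beginning is last, after the bottom, one horizontal edge and the top.
    have key : ∀ d : F.Dart, (hd : d.1 ∈ A) → src d = v.1 →
        ∃ hi : (if d.2 then (ψ.emap ⟨d.1, hA.1.mem hd⟩).length + 2 else 1) <
          ((mappingTorus ψ).bdry ⟨d.1, hA.1.mem hd⟩).length,
        (((mappingTorus ψ).bdry ⟨d.1, hA.1.mem hd⟩)[if d.2 then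
          (ψ.emap ⟨d.1, hA.1.mem hd⟩).length + 2 else 1]).1 = Sum.inr v := by
      rintro ⟨e, _ | _⟩ hd hv
      · exact ⟨by simp [mappingTorus], congrArg Sum.inr (Subtype.ext hv)⟩
      · refine ⟨by simp [mappingTorus, revPath], ?_⟩
        simp only [mappingTorus, if_true, List.getElem_cons_succ]
        rw [List.getElem_append_right (by simp [revPath])]
        simp only [List.getElem_singleton]
        exact congrArg Sum.inr (Subtype.ext hv)
    obtain ⟨d', hd', h1, h2⟩ := hA.1.2.1 d hd
    obtain ⟨hi, h3⟩ := key d hd hv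
    obtain ⟨hi', h4⟩ := key d' hd' (h1.trans hv)
    refine hA.1.subtorus.not_isFreeEdge_and_not_isIsolatedEdge ⟨Sum.inr v, ⟨d, hd, hv⟩⟩
      (c := ⟨d.1, hA.1.mem hd⟩) (c' := ⟨d'.1, hA.1.mem hd'⟩) hd hd' hi hi' h3 h4 ?_
    intro hc hi
    have hfst : d.1 = d'.1 := congrArg Subtype.val hc
    rcases eq_or_eq_rev hfst with rfl | rfl
    · exact h2 rfl
    · rcases d' with ⟨e, _ | _⟩ <;>
        simp [rev] at hi

/-- Horizontal edges cancel the vertices, and 2-cells cancel the vertical edges. -/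
lemma IsInvariantCore.eulerChar_subtorus [Finite F.V] [Finite F.E] (hA : ψ.IsInvariantCore A) :
    hA.subtorus.toTwoComplex.eulerChar = 0 := by
  have h1 : Nat.card hA.subtorus.toTwoComplex.graph.E = Nat.card A + Nat.card (endpoints A) := by
    rw [← Nat.card_sum]
    refine Nat.card_congr ⟨fun s => match s with
      | ⟨Sum.inl e, he⟩ => Sum.inl ⟨e, he⟩
      | ⟨Sum.inr v, hv⟩ => Sum.inr ⟨v.1, hv⟩, fun s => match s with
      | Sum.inl e => ⟨Sum.inl e.1, e.2⟩
      | Sum.inr v => ⟨Sum.inr ⟨v.1, hA.endpoints_subset v.2⟩, v.2⟩, ?_, ?_⟩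
    · rintro ⟨e | v, h⟩ <;> rfl
    · rintro (e | v) <;> rfl
  have h2 : Nat.card hA.subtorus.toTwoComplex.C = Nat.card A :=
    Nat.card_congr ⟨fun c => ⟨c.1.1, c.2⟩, fun e => ⟨⟨e.1, hA.mem e.2⟩, e.2⟩,
      fun _ => rfl, fun _ => rfl⟩
  have h3 : Nat.card hA.subtorus.toTwoComplex.graph.V = Nat.card (endpoints (G := F) A) := rfl
  rw [TwoComplex.eulerChar, h1, h2, h3]
  push_cast
  ring

/-- The forward orbit of a vertex under `ψ` is eventually periodic; following horizontal edges
around the period gives a loop of positive height. -/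
lemma IsInvariantCore.not_hasTrivialPi1_subtorus [Finite F.V] (hA : ψ.IsInvariantCore A) :
    ¬ hA.subtorus.toTwoComplex.HasTrivialPi1 := by
  let g : endpoints A → endpoints A := fun v =>
    ⟨ψ.vmap ⟨v.1, hA.endpoints_subset v.2⟩, hA.vmap_mem v.2⟩
  have key : ∀ (k : ℕ) (v : endpoints A),
      ∃ l : List hA.subtorus.toTwoComplex.graph.Dart,
      IsPath (G := hA.subtorus.toTwoComplex.graph) v l (g^[k] v) ∧
      torusHeight ψ (l.map fun d => (hA.subtorus.incl.emap d.1, d.2)) = k := by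
    intro k
    induction k with
    | zero => exact fun v => ⟨[], rfl, rfl⟩
    | succ k ih =>
      intro v
      obtain ⟨l, h1, h2⟩ := ih (g v)
      refine ⟨(⟨Sum.inr ⟨v.1, hA.endpoints_subset v.2⟩, v.2⟩, true) :: l, ⟨rfl, h1⟩, ?_⟩
      simp only [torusHeight, List.map_cons, List.sum_cons] at h2 ⊢
      rw [h2]
      push_cast
      exact add_comm _ _
  obtain ⟨e, he⟩ := hA.1
  let v : endpoints A := ⟨F.ini e, src_mem_endpoints (d := (e, true)) he⟩
  obtain ⟨m, n, hmn, h⟩ := Finite.exists_ne_map_eq_of_infinite fun k : ℕ => g^[k] v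
  wlog hlt : m < n generalizing m n
  · exact this n m hmn.symm h.symm (by omega)
  obtain ⟨k, rfl⟩ := Nat.exists_eq_add_of_lt hlt
  obtain ⟨l, h1, h2⟩ := key (k + 1) (g^[m] v)
  have h3 : g^[k + 1] (g^[m] v) = g^[m] v := by
    rw [← Function.iterate_add_apply, show k + 1 + m = m + k + 1 by omega]
    exact h.symm
  rw [h3] at h1
  refine not_hasTrivialPi1_of_torusHeight hA.subtorus.incl h1 ?_
  rw [h2]
  positivity

lemma not_negativeImmersions [Finite F.V] [Finite F.E] (hψ : ψ.IsImmersion)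
    (hA : ψ.IsInvariantCore A) : ¬ (mappingTorus ψ).NegativeImmersions := by
  rintro ⟨c, hc, h⟩
  obtain ⟨B, -, hB⟩ := (Set.toFinite {A | ψ.IsInvariantCore A}).exists_le_minimal hA
  have hB : Minimal ψ.IsInvariantCore B := hB
  have hfin : (mappingTorus ψ).IsFinite := by
    refine ⟨‹_›, ?_, Subtype.finite⟩
    change Finite (F.E ⊕ H.verts)
    infer_instance
  have hface := IsInvariantCore.faces_subtorus hψ hB
  rcases h _ hB.1.subtorus.incl hB.1.subtorus.isImmersion_incl
    (TwoComplex.Subcomplex.isFinite_toTwoComplex hfin _) (IsInvariantCore.connected_subtorus hB)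
    (TwoComplex.isCollapsed_of hface) (fun e => (hface e).2) with h | h
  · exact hB.1.not_hasTrivialPi1_subtorus h
  · have hcard : 0 < Nat.card hB.1.subtorus.toTwoComplex.C := by
      have := (TwoComplex.Subcomplex.isFinite_toTwoComplex hfin hB.1.subtorus).2.2
      obtain ⟨e, he⟩ := hB.1.1
      have : Nonempty hB.1.subtorus.toTwoComplex.C := ⟨⟨⟨e, hB.1.mem he⟩, he⟩⟩
      exact Nat.card_pos
    rw [hB.1.eulerChar_subtorus, Int.cast_zero] at h
    have : 0 < c * (Nat.card hB.1.subtorus.toTwoComplex.C : ℝ) := by positivity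
    linarith

end CellularMap

/-! ### Partial maps whose mapping torus immerses in that of `ψ`. -/

lemma CellularMap.isPath_flatMap {G F : MGraph.{u}} (φ : CellularMap G F) {x y : G.V}
    {l : List G.Dart} (h : IsPath x l y) :
    IsPath (φ.vmap x) (l.flatMap φ.dartMap) (φ.vmap y) := by
  induction l generalizing x with
  | nil => exact congrArg φ.vmap h
  | cons d l ih =>
    obtain ⟨rfl, h2⟩ := h
    exact isPath_append.2 ⟨_, φ.isPath_dartMap d, ih h2⟩

/-- A partial map `φ`, defined on the subgraph `S` of `Γ`, with an immersion of its mapping torus to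
the mapping torus of `ψ`. -/
structure PartialLift {F : MGraph.{u}} {H : Subgraph F} (ψ : CellularMap H.toGraph F) where
  Γ : MGraph.{u}
  S : MGraph.{u}
  φ : CellularMap S Γ
  baseV : S.V → Γ.V
  baseE : S.E → Γ.E
  ini_baseE : ∀ c, Γ.ini (baseE c) = baseV (S.ini c)
  ter_baseE : ∀ c, Γ.ter (baseE c) = baseV (S.ter c)
  baseV_injective : Function.Injective baseV
  baseE_injective : Function.Injective baseE
  labV : Γ.V → F.V
  labE : Γ.E → F.E
  ini_labE : ∀ e, F.ini (labE e) = labV (Γ.ini e)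
  ter_labE : ∀ e, F.ter (labE e) = labV (Γ.ter e)
  lab_injective : ∀ d d' : Γ.Dart, src d = src d' → labE d.1 = labE d'.1 → d.2 = d'.2 → d = d'
  lab_mem : ∀ c, labE (baseE c) ∈ H.edges
  map_emap : ∀ c, (φ.emap c).map (fun d => (labE d.1, d.2)) = ψ.emap ⟨labE (baseE c), lab_mem c⟩

namespace PartialLift

variable {F : MGraph.{u}} {H : Subgraph F} {ψ : CellularMap H.toGraph F} (D : PartialLift ψ)

def lab (d : D.Γ.Dart) : F.Dart := (D.labE d.1, d.2)

def base (s : D.S.Dart) : D.Γ.Dart := (D.baseE s.1, s.2)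

lemma src_lab (d : D.Γ.Dart) : src (D.lab d) = D.labV (src d) := by
  rcases d with ⟨e, _ | _⟩
  · exact D.ter_labE e
  · exact D.ini_labE e

lemma lab_rev (d : D.Γ.Dart) : D.lab (rev d) = rev (D.lab d) := rfl

lemma tgt_lab (d : D.Γ.Dart) : tgt (D.lab d) = D.labV (tgt d) := by
  rw [← src_rev, ← lab_rev, src_lab, src_rev]

lemma eq_of_lab_eq {d d' : D.Γ.Dart} (h : src d = src d') (h' : D.lab d = D.lab d') : d = d' :=
  D.lab_injective d d' h (congrArg Prod.fst h') (congrArg Prod.snd h' :)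

lemma src_base (s : D.S.Dart) : src (D.base s) = D.baseV (src s) := by
  rcases s with ⟨e, _ | _⟩
  · exact D.ter_baseE e
  · exact D.ini_baseE e

lemma tgt_base (s : D.S.Dart) : tgt (D.base s) = D.baseV (tgt s) := by
  rw [← src_rev, ← src_rev, ← src_base]
  rfl

lemma base_injective : Function.Injective D.base := fun _ _ h =>
  Prod.ext (D.baseE_injective (congrArg Prod.fst h)) (congrArg Prod.snd h :)

lemma map_dartMap (s : D.S.Dart) :
    (D.φ.dartMap s).map D.lab = ψ.dartMap (⟨D.labE (D.baseE s.1), D.lab_mem s.1⟩, s.2) := by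
  have h := D.map_emap s.1
  rcases s with ⟨c, _ | _⟩
  · simp only [CellularMap.dartMap, Bool.false_eq_true, if_false]
    rw [← h]
    simp [revPath, List.map_reverse, Function.comp_def, lab, rev]
  · exact h

lemma isImmersion (hψ : ψ.IsImmersion) : D.φ.IsImmersion where
  reduced c := by
    have h := hψ.reduced ⟨D.labE (D.baseE c), D.lab_mem c⟩
    rw [← D.map_emap c, List.isChain_map] at h
    refine h.imp fun a b hab hba => hab ?_
    rw [hba]
    rfl
  injective_at_vertex s s' h h' := by
    have h2 := congrArg (Option.map D.lab) h'
    rw [← List.head?_map, ← List.head?_map, map_dartMap, map_dartMap] at h2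
    have h3 : src (D.base s) = src (D.base s') := by rw [src_base, src_base, h]
    have h5 : src (D.lab (D.base s)) = src (D.lab (D.base s')) := by rw [src_lab, src_lab, h3]
    have h4 := hψ.injective_at_vertex _ _ (Subtype.ext (by
      rcases s with ⟨c, _ | _⟩ <;> rcases s' with ⟨c', _ | _⟩ <;> exact h5)) h2
    exact D.base_injective (D.eq_of_lab_eq h3
      (Prod.ext (congrArg (fun d => d.1.1) h4) (congrArg Prod.snd h4 :)))

/-- The conditions that hold when the mapping torus of `φ` is collapsed, connected and more than
a point. -/
structure IsFull : Prop where
  isCore : IsCore (Set.univ : Set D.S.E)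
  covered : ∀ e : D.Γ.E, ∃ c, ∃ d ∈ D.φ.emap c, d.1 = e
  exists_dart : ∀ v : D.Γ.V, ∃ d : D.Γ.Dart, src d = v

variable {D}

lemma IsFull.isCore_univ (hD : D.IsFull) (hψ : ψ.IsImmersion) :
    IsCore (Set.univ : Set D.Γ.E) := by
  have h := (D.isImmersion hψ).isCore_edgeImage hD.isCore
  convert h
  refine (Set.eq_univ_of_forall fun e => ?_).symm
  obtain ⟨c, d, hd, h⟩ := hD.covered e
  exact ⟨c, trivial, d, hd, h⟩

/-! ### The frontier and its distance from the vertices of `S`. -/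

variable (D)

/-- A vertex of `S` with a half-edge of `Γ` outside `S`. -/
def IsFrontier (v : D.Γ.V) : Prop :=
  v ∈ Set.range D.baseV ∧ ∃ d : D.Γ.Dart, src d = v ∧ d.1 ∉ Set.range D.baseE

/-- Walks in the `1`-skeleton of the mapping torus of `φ` that traverse horizontal edges forwards
only. Horizontal edges are labelled `none`. -/
def Walk : D.Γ.V → List (Option F.Dart) → D.Γ.V → Prop
  | x, [], y => x = y
  | x, none :: w, y => ∃ h, D.baseV h = x ∧ Walk (D.φ.vmap h) w y
  | x, some a :: w, y => ∃ d, src d = x ∧ D.lab d = a ∧ Walk (tgt d) w y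

variable {D}

/-- Walks are deterministic: labels separate the vertical half-edges at a vertex, and at most one
horizontal edge starts there. This allows counting endpoints by words. -/
lemma Walk.eq {x y y' : D.Γ.V} {w : List (Option F.Dart)} (h : D.Walk x w y)
    (h' : D.Walk x w y') : y = y' := by
  induction w generalizing x with
  | nil => exact Eq.trans (Eq.symm h) h'
  | cons a w ih =>
    rcases a with _ | a
    · obtain ⟨s, hs, h⟩ := h
      obtain ⟨s', hs', h'⟩ := h'
      obtain rfl := D.baseV_injective (hs.trans hs'.symm)
      exact ih h h'
    · obtain ⟨d, hd, hda, h⟩ := h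
      obtain ⟨d', hd', hda', h'⟩ := h'
      obtain rfl := D.eq_of_lab_eq (hd.trans hd'.symm) (hda.trans hda'.symm)
      exact ih h h'

lemma Walk.append {x y z : D.Γ.V} {w w' : List (Option F.Dart)} (h : D.Walk x w y)
    (h' : D.Walk y w' z) : D.Walk x (w ++ w') z := by
  induction w generalizing x with
  | nil =>
    obtain rfl : x = y := h
    exact h'
  | cons a w ih =>
    rcases a with _ | a
    · obtain ⟨s, hs, h⟩ := h
      exact ⟨s, hs, ih h⟩
    · obtain ⟨d, hd, hda, h⟩ := h
      exact ⟨d, hd, hda, ih h⟩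

lemma walk_of_isPath {x y : D.Γ.V} {l : List D.Γ.Dart} (h : IsPath x l y) :
    D.Walk x (l.map fun d => some (D.lab d)) y := by
  induction l generalizing x with
  | nil => exact h
  | cons d l ih => exact ⟨d, h.1, rfl, ih h.2⟩

variable (D)

/-- `D.Near r x y`: there is a walk of length at most `r` from `x` to `y`. -/
def Near (r : ℕ) (x y : D.Γ.V) : Prop := ∃ w, w.length ≤ r ∧ D.Walk x w y

variable {D}

lemma Near.trans {r r' : ℕ} {x y z : D.Γ.V} (h : D.Near r x y) (h' : D.Near r' y z) :
    D.Near (r + r') x z := by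
  obtain ⟨w, hw, h⟩ := h
  obtain ⟨w', hw', h'⟩ := h'
  exact ⟨w ++ w', by rw [List.length_append]; omega, h.append h'⟩

lemma Near.mono {r r' : ℕ} (hr : r ≤ r') {x y : D.Γ.V} (h : D.Near r x y) : D.Near r' x y := by
  obtain ⟨w, hw, h⟩ := h
  exact ⟨w, hw.trans hr, h⟩

/-- The first vertex where the path leaves `S` would be a frontier vertex, and the reversed initial
segment a short walk from it to `baseV h`. -/
lemma exists_isPath_base {r : ℕ} {h : D.S.V} {y : D.Γ.V} {l : List D.Γ.Dart}
    (hfar : ∀ u, D.IsFrontier u → ¬ D.Near r u (D.baseV h)) (hl : IsPath (D.baseV h) l y)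
    (hr : l.length ≤ r) : ∃ m h', IsPath h m h' ∧ m.map D.base = l := by
  induction l generalizing h r with
  | nil => exact ⟨[], h, rfl, rfl⟩
  | cons d l ih =>
    obtain ⟨h1, h2⟩ := hl
    have hmem : d.1 ∈ Set.range D.baseE := by
      by_contra hd
      exact hfar _ ⟨⟨h, rfl⟩, d, h1, hd⟩ ⟨[], by simp, rfl⟩
    obtain ⟨s, rfl⟩ : ∃ s, D.base s = d := by
      obtain ⟨c, hc⟩ := hmem
      exact ⟨(c, d.2), Prod.ext hc rfl⟩
    rw [src_base] at h1
    obtain rfl := D.baseV_injective h1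
    rw [tgt_base] at h2
    rw [List.length_cons] at hr
    obtain ⟨m, h', h3, h4⟩ := ih (r := r - 1) (fun u hu hn => by
      refine hfar u hu ((hn.trans (r' := 1) ⟨[some (D.lab (rev (D.base s)))], le_rfl, ?_⟩).mono
        (by omega))
      exact ⟨rev (D.base s), by rw [src_rev, tgt_base], rfl, by rw [tgt_rev, src_base]; rfl⟩)
      h2 (by omega)
    exact ⟨s :: m, h', ⟨rfl, h3⟩, by rw [List.map_cons, h4]⟩

lemma length_dartMap_le {L : ℕ} (hL : ∀ e, (ψ.emap e).length ≤ L) (s : D.S.Dart) :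
    (D.φ.dartMap s).length ≤ L := by
  have h : (D.φ.emap s.1).length ≤ L := by
    rw [← List.length_map, D.map_emap]
    exact hL _
  rcases s with ⟨c, _ | _⟩ <;> simpa [CellularMap.dartMap, revPath] using h

lemma length_flatMap_dartMap_le {L : ℕ} (hL : ∀ e, (ψ.emap e).length ≤ L)
    (m : List D.S.Dart) : (m.flatMap D.φ.dartMap).length ≤ L * m.length := by
  induction m with
  | nil => simp
  | cons s m ih =>
    have := D.length_dartMap_le hL s
    rw [List.flatMap_cons, List.length_append, List.length_cons, Nat.mul_succ]
    omega

/-- Far from the frontier, there are vertices around which all edges survive. -/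
lemma exists_survives [Finite F.E] (ψ : CellularMap H.toGraph F) (n r : ℕ) :
    ∃ T, ∀ D : PartialLift ψ, D.IsFull → ∀ h₀ : D.S.V,
      (∀ u, D.IsFrontier u → ¬ D.Near T u (D.baseV h₀)) →
      ∃ h, D.Near T (D.baseV h) (D.baseV h₀) ∧ ∀ l y, IsPath (D.baseV h) l y → l.length ≤ r →
        ∀ d ∈ l, ψ.Survives n (D.labE d.1) := by
  induction n generalizing r with
  | zero =>
    refine ⟨r, fun D hD h₀ hfar => ⟨h₀, ⟨[], by simp, rfl⟩, fun l y hl hr d hd => ?_⟩⟩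
    obtain ⟨m, h', -, rfl⟩ := exists_isPath_base hfar hl hr
    obtain ⟨s, -, rfl⟩ := List.mem_map.1 hd
    exact D.lab_mem s.1
  | succ n ih =>
    obtain ⟨L, hL⟩ : ∃ L, ∀ e, (ψ.emap e).length ≤ L := by
      have : Finite H.toGraph.E := Subtype.finite
      obtain ⟨L, hL⟩ := (Set.finite_range fun e => (ψ.emap e).length).bddAbove
      exact ⟨L, fun e => hL ⟨e, rfl⟩⟩
    -- `L` bounds the way from the upstream image vertex to the start of an image path, and `L * r`
    -- bounds the image of a path of length `r`.
    obtain ⟨T, hT⟩ := ih (L + L * r)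
    refine ⟨r + (1 + L + T), fun D hD h₀ hfar => ?_⟩
    obtain ⟨h, hnear, hsurv⟩ := hT D hD h₀ fun u hu hn => hfar u hu (hn.mono (by omega))
    -- The upstream move: some edge at `h` lies on the image of a half-edge `s` of `S`, so `src s`
    -- reaches `h` by one horizontal edge and the part `l₁` of that image. The ball around `src s`
    -- lies in `S`, and `φ` maps it into the surviving ball around `h`.
    obtain ⟨d, hd⟩ := hD.exists_dart (D.baseV h)
    obtain ⟨c, d', hd', hdd⟩ := hD.covered d.1
    obtain ⟨s, -, hs⟩ := D.φ.exists_mem_dartMap hd' hdd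
    obtain ⟨l₁, l₂, hl⟩ := List.append_of_mem hs
    have hpath := D.φ.isPath_dartMap s
    have hlen := length_dartMap_le hL s
    rw [hl] at hpath hlen
    obtain ⟨z, h1, h2, -⟩ := isPath_append.1 hpath
    obtain rfl : D.baseV h = z := hd.symm.trans h2
    rw [List.length_append, List.length_cons] at hlen
    have hnear' : D.Near (1 + L + T) (D.baseV (src s)) (D.baseV h₀) := by
      refine Near.trans ⟨none :: l₁.map fun d => some (D.lab d), ?_, _, rfl, walk_of_isPath h1⟩ hnear
      simp only [List.length_cons, List.length_map]
      omega
    refine ⟨src s, hnear'.mono (by omega), fun l y hl hr x hx => ?_⟩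
    obtain ⟨m, h', hm, rfl⟩ := exists_isPath_base
      (fun u hu hn => hfar u hu (hn.trans hnear')) hl hr
    rw [List.length_map] at hr
    obtain ⟨t, ht, rfl⟩ := List.mem_map.1 hx
    refine ⟨D.lab_mem t.1, fun a ha => ?_⟩
    replace ha := (D.map_emap t.1).symm ▸ ha
    obtain ⟨b, hb, rfl⟩ := List.mem_map.1 ha
    obtain ⟨b', hb', hbb⟩ : ∃ b' ∈ D.φ.dartMap t, b'.1 = b.1 := by
      rcases t with ⟨c, _ | _⟩
      · exact ⟨rev b, by simpa [CellularMap.dartMap, mem_revPath, rev_rev] using hb, rfl⟩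
      · exact ⟨b, by simpa [CellularMap.dartMap] using hb, rfl⟩
    have := hsurv (revPath l₁ ++ m.flatMap D.φ.dartMap) _
      (isPath_append.2 ⟨_, h1.revPath, D.φ.isPath_flatMap hm⟩) ?_ b'
      (List.mem_append_right _ (List.mem_flatMap.2 ⟨t, ht, hb'⟩))
    · rwa [hbb] at this
    · have h3 := length_flatMap_dartMap_le hL m
      have h4 : L * m.length ≤ L * r := Nat.mul_le_mul_left L hr
      rw [List.length_append, revPath, List.length_reverse, List.length_map]
      omega

/-- If some iterated preimage is a forest, the frontier is near every vertex of `S`. -/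
lemma exists_frontier_near [Finite F.V] [Finite F.E] (hψ : ψ.IsImmersion) {n : ℕ}
    (hn : (ψ.iteratedPreimage n).IsForest) :
    ∃ T, ∀ D : PartialLift ψ, D.IsFull → ∀ h : D.S.V,
      ∃ u, D.IsFrontier u ∧ D.Near T u (D.baseV h) := by
  -- Radius `Nat.card F.V` suffices: within that many steps, a ray in `F` runs around an embedded
  -- circle.
  obtain ⟨T, hT⟩ := exists_survives ψ n (Nat.card F.V)
  refine ⟨T, fun D hD h₀ => ?_⟩
  by_contra! hfar
  obtain ⟨h, -, hs⟩ := hT D hD h₀ hfar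
  obtain ⟨d, hd⟩ := hD.exists_dart (D.baseV h)
  obtain ⟨p, hp, rfl, -⟩ := (hD.isCore_univ hψ).exists_ray (d := d) trivial
  have hray : IsRay fun i => D.lab (p i) := fun i => by
    obtain ⟨h1, h2⟩ := hp i
    refine ⟨by rw [src_lab, tgt_lab, h1], fun h => h2 ?_⟩
    exact D.eq_of_lab_eq (by rw [h1, src_rev]) h
  obtain ⟨l, hl, hlp⟩ := hray.exists_isEmbeddedCircle
  refine (ψ.not_isForest_iteratedPreimage_iff n).2 ⟨{e | ∃ d ∈ l, d.1 = e}, ?_, hl.isCore, ?_⟩ hn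
  · obtain ⟨d, hd⟩ := List.exists_mem_of_ne_nil l hl.1
    exact ⟨d.1, d, hd, rfl⟩
  · rintro _ ⟨d, hd', rfl⟩
    obtain ⟨i, hi, rfl⟩ := hlp d hd'
    have hpath := hp.isPath 0 (Nat.card F.V)
    rw [hd] at hpath
    exact hs _ _ hpath (by simp) (p i) (List.mem_map.2 ⟨i, List.mem_range.2 hi, by simp⟩)

/-! ### Counting half-edges and 2-cells against the frontier. -/

/-- Half-edges of `S`, one half-edge outside `S` for each frontier vertex, and two half-edges at
each vertex outside `S` are all distinct half-edges of `Γ`. For the mapping torus of `φ` the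
inequality says that the frontier has at most `-2χ` elements. -/
lemma card_frontier_le [Finite D.Γ.V] [Finite D.Γ.E] [Finite D.S.E] [Finite D.S.V]
    (hD : D.IsFull) (hψ : ψ.IsImmersion) :
    2 * Nat.card D.S.E + Nat.card {v // D.IsFrontier v} + 2 * Nat.card D.Γ.V ≤
      2 * Nat.card D.Γ.E + 2 * Nat.card D.S.V := by
  have two : ∀ v : D.Γ.V, ∃ d d' : D.Γ.Dart, src d = v ∧ src d' = v ∧ d' ≠ d := fun v => by
    obtain ⟨d, hd⟩ := hD.exists_dart v
    obtain ⟨d', -, h1, h2⟩ := hD.isCore_univ hψ d trivial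
    exact ⟨d, d', hd, h1.trans hd, h2⟩
  choose a b ha hb hab using two
  choose g hg hgE using fun v : {v // D.IsFrontier v} => v.2.2
  let F₀ : D.S.Dart ⊕ {v // D.IsFrontier v} ⊕ ({v // v ∉ Set.range D.baseV} × Bool) → D.Γ.Dart :=
    Sum.elim D.base (Sum.elim g fun x => if x.2 then a x.1 else b x.1)
  have hout : ∀ x : {v // v ∉ Set.range D.baseV} × Bool,
      src (if x.2 then a x.1 else b x.1) = x.1.1 := by
    rintro ⟨v, _ | _⟩
    · exact hb v
    · exact ha v
  have hF₀ : Function.Injective F₀ := by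
    refine D.base_injective.sumElim (Function.Injective.sumElim ?_ ?_ ?_) ?_
    · intro v v' h
      exact Subtype.ext (by rw [← hg v, ← hg v', h])
    · intro x x' h
      have h1 : x.1 = x'.1 := Subtype.ext (by rw [← hout x, ← hout x']; exact congrArg src h)
      obtain ⟨v, i⟩ := x
      obtain ⟨v', i'⟩ := x'
      obtain rfl : v = v' := h1
      rcases i with _ | _ <;> rcases i' with _ | _
      · rfl
      · exact absurd h.symm (by simpa using (hab v).symm)
      · exact absurd h.symm (by simpa using hab v)
      · rfl
    · intro v x h
      refine x.1.2 ?_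
      rw [← hout x, ← h, hg v]
      exact v.2.1
    · rintro s (v | x) h
      · exact hgE v ⟨s.1, congrArg Prod.fst h⟩
      · refine x.1.2 ⟨src s, ?_⟩
        rw [← src_base, ← hout x]
        exact congrArg src h
  have hcard := Nat.card_le_card_of_injective F₀ hF₀
  have hcompl : Nat.card D.S.V + Nat.card {v // v ∉ Set.range D.baseV} = Nat.card D.Γ.V := by
    have h1 : Nat.card (Set.range D.baseV) = Nat.card D.S.V :=
      Nat.card_range_of_injective D.baseV_injective
    classical
    rw [← h1, ← Nat.card_sum]
    exact Nat.card_congr (Equiv.sumCompl (· ∈ Set.range D.baseV))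
  have hbool : Nat.card Bool = 2 := by simp
  simp only [Nat.card_sum, Nat.card_prod, hbool] at hcard
  omega

/-- An edge of `S` is determined by its initial vertex and its label, and the initial vertex by a
frontier vertex and a word of length at most `T`. -/
lemma card_le_mul_card_frontier [Finite F.V] [Finite F.E] (hψ : ψ.IsImmersion) {n : ℕ}
    (hn : (ψ.iteratedPreimage n).IsForest) :
    ∃ K : ℕ, ∀ D : PartialLift ψ, D.IsFull → Finite D.Γ.V →
      Nat.card D.S.E ≤ K * Nat.card {v // D.IsFrontier v} := by
  obtain ⟨T, hT⟩ := exists_frontier_near hψ hn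
  have hfin : Finite {w : List (Option F.Dart) // w.length ≤ T} := List.finite_length_le _ T
  refine ⟨Nat.card ({w : List (Option F.Dart) // w.length ≤ T} × F.E), fun D hD hΓ => ?_⟩
  rw [← Nat.card_prod]
  choose u hu w hw hwalk using fun c => hT D hD (D.S.ini c)
  refine Nat.card_le_card_of_injective
    (fun c => ((⟨w c, hw c⟩, D.labE (D.baseE c)), ⟨u c, hu c⟩)) fun c c' h => ?_
  simp only [Prod.mk.injEq, Subtype.mk.injEq] at h
  obtain ⟨⟨h1, h2⟩, h3⟩ := h
  have h4 := hwalk c'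
  rw [← h1, ← h3] at h4
  have h5 := (hwalk c).eq h4
  have h6 := D.lab_injective (D.baseE c, true) (D.baseE c', true)
    ((D.ini_baseE c).trans (h5.trans (D.ini_baseE c').symm)) h2 rfl
  exact D.baseE_injective (congrArg Prod.fst h6)

end PartialLift

/-! ### Immersed complexes as mapping tori of partial maps. -/

namespace TwoComplex

/-- An edge that is not a free face is traversed again after any given traversal. -/
lemma exists_other_occurrence {Y : TwoComplex.{u}} {e : Y.graph.E} (he : ¬ Y.IsFreeEdge e)
    {c : Y.C} {i : ℕ} (h : ((Y.bdry c).map Prod.fst)[i]? = some e) :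
    ∃ (c' : Y.C) (i' : ℕ), ((Y.bdry c').map Prod.fst)[i']? = some e ∧ (c' = c → i' ≠ i) := by
  by_contra! hno
  obtain ⟨hi, h⟩ := List.getElem?_eq_some_iff.1 h
  rw [List.length_map] at hi
  refine he ⟨⟨c, ⟨i, hi⟩⟩, by simpa using h, ?_⟩
  rintro ⟨c', ⟨i', hi'⟩⟩ h'
  obtain ⟨rfl, rfl⟩ := hno c' i'
    (List.getElem?_eq_some_iff.2 ⟨by simpa using hi', by simpa using h'⟩)
  rfl

lemma exists_occurrence {Y : TwoComplex.{u}} {e : Y.graph.E} (he : ¬ Y.IsIsolatedEdge e) :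
    ∃ (c : Y.C) (i : ℕ), ((Y.bdry c).map Prod.fst)[i]? = some e := by
  simp only [IsIsolatedEdge, not_forall, not_not] at he
  obtain ⟨c, hc⟩ := he
  exact ⟨c, List.mem_iff_getElem?.1 hc⟩

namespace CombMap

variable {F : MGraph.{u}} {H : Subgraph F} {ψ : CellularMap H.toGraph F} {Y : TwoComplex.{u}}
  (f : CombMap Y (mappingTorus ψ))

/-- The preimage of `F`, with its vertical edges labelled by their images. -/
def vert : MGraph.{u} where
  V := Y.graph.V
  E := {p : Y.graph.E × F.E // f.emap p.1 = Sum.inl p.2}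
  ini p := Y.graph.ini p.1.1
  ter p := Y.graph.ter p.1.1

/-- The horizontal edges, labelled by their images. -/
def Hor : Type u := {p : Y.graph.E × H.verts // f.emap p.1 = Sum.inr p.2}

def vertDart (d : f.vert.Dart) : Y.graph.Dart := (d.1.1.1, d.2)

def vertLab (d : f.vert.Dart) : F.Dart := (d.1.1.2, d.2)

lemma isPath_vert_iff {x y : Y.graph.V} {l : List f.vert.Dart} :
    IsPath (G := f.vert) x l y ↔ IsPath x (l.map f.vertDart) y := by
  induction l generalizing x with
  | nil => rfl
  | cons d l ih => exact and_congr Iff.rfl ih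

lemma exists_map_vertDart {m : List Y.graph.Dart} {l : List F.Dart}
    (h : l.map (vertical ψ) = m.map fun d => (f.emap d.1, d.2)) :
    ∃ k : List f.vert.Dart, k.map f.vertDart = m ∧ k.map f.vertLab = l := by
  induction m generalizing l with
  | nil =>
    obtain rfl : l = [] := List.map_eq_nil_iff.1 h
    exact ⟨[], rfl, rfl⟩
  | cons d m ih =>
    cases l with
    | nil => simp at h
    | cons a l =>
      obtain ⟨h0, h⟩ := List.cons.inj h
      obtain ⟨k, rfl, rfl⟩ := ih h
      have h1 : Sum.inl a.1 = f.emap d.1 := congrArg Prod.fst h0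
      have h2 : a.2 = d.2 := congrArg Prod.snd h0
      exact ⟨(⟨(d.1, a.1), h1.symm⟩, d.2) :: k, rfl, by
        rw [List.map_cons, List.cons.injEq]
        exact ⟨Prod.ext rfl h2.symm, rfl⟩⟩

/-- The boundary of a `2`-cell of `Y`: a vertical edge, a horizontal edge, a vertical path backwards
and a horizontal edge backwards. -/
lemma exists_bdry_eq (c : Y.C) : ∃ x : f.vert.E × f.Hor × f.Hor × List f.vert.Dart,
    Y.bdry c = (x.1.1.1, true) :: (x.2.1.1.1, true) ::
      ((revPath x.2.2.2).map f.vertDart ++ [(x.2.2.1.1.1, false)]) ∧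
    x.1.1.2 = (f.cmap c).1 ∧ x.2.1.1.2 = H.toGraph.ter (f.cmap c) ∧
    x.2.2.1.1.2 = H.toGraph.ini (f.cmap c) ∧ x.2.2.2.map f.vertLab = ψ.emap (f.cmap c) := by
  have h : (Sum.inl (f.cmap c).1, true) :: (Sum.inr (H.toGraph.ter (f.cmap c)), true) ::
      ((revPath (ψ.emap (f.cmap c))).map (vertical ψ) ++
        ([(Sum.inr (H.toGraph.ini (f.cmap c)), false)] : List (torusGraph ψ).Dart)) =
      (Y.bdry c).map (fun d => (f.emap d.1, d.2)) := f.bdry_cmap c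
  obtain ⟨b, l₁, hl, hb, h⟩ := List.map_eq_cons_iff.1 h.symm
  obtain ⟨h₁, l₂, rfl, hh₁, h⟩ := List.map_eq_cons_iff.1 h
  obtain ⟨l₃, l₄, rfl, hl₃, h'⟩ := List.map_eq_append_iff.1 h
  obtain ⟨h₀, l₅, rfl, hh₀, h'⟩ := List.map_eq_cons_iff.1 h'
  obtain rfl := List.map_eq_nil_iff.1 h'
  obtain ⟨k, rfl, hk⟩ := f.exists_map_vertDart hl₃.symm
  refine ⟨⟨⟨(b.1, (f.cmap c).1), congrArg Prod.fst hb⟩,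
    ⟨(h₁.1, H.toGraph.ter (f.cmap c)), congrArg Prod.fst hh₁⟩,
    ⟨(h₀.1, H.toGraph.ini (f.cmap c)), congrArg Prod.fst hh₀⟩, revPath k⟩, ?_, rfl, rfl, rfl, ?_⟩
  · rw [hl, revPath_revPath]
    have e1 : b = (b.1, true) := Prod.ext rfl (congrArg Prod.snd hb :)
    have e2 : h₁ = (h₁.1, true) := Prod.ext rfl (congrArg Prod.snd hh₁ :)
    have e3 : h₀ = (h₀.1, false) := Prod.ext rfl (congrArg Prod.snd hh₀ :)
    rw [← e1, ← e2, ← e3]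
  · have : (revPath k).map f.vertLab = revPath (k.map f.vertLab) := by
      simp [revPath, List.map_reverse, Function.comp_def, vertLab, rev]
    rw [this, hk, revPath_revPath]

noncomputable def bot (c : Y.C) : f.vert.E := (f.exists_bdry_eq c).choose.1

noncomputable def horTer (c : Y.C) : f.Hor := (f.exists_bdry_eq c).choose.2.1

noncomputable def horIni (c : Y.C) : f.Hor := (f.exists_bdry_eq c).choose.2.2.1

noncomputable def top (c : Y.C) : List f.vert.Dart := (f.exists_bdry_eq c).choose.2.2.2

lemma bdry_eq (c : Y.C) : Y.bdry c = ((f.bot c).1.1, true) :: ((f.horTer c).1.1, true) ::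
    ((revPath (f.top c)).map f.vertDart ++ [((f.horIni c).1.1, false)]) :=
  (f.exists_bdry_eq c).choose_spec.1

lemma bot_lab (c : Y.C) : (f.bot c).1.2 = (f.cmap c).1 :=
  (f.exists_bdry_eq c).choose_spec.2.1

lemma map_top (c : Y.C) : (f.top c).map f.vertLab = ψ.emap (f.cmap c) :=
  (f.exists_bdry_eq c).choose_spec.2.2.2.2

lemma ends_eq (c : Y.C) : Y.graph.ini (f.bot c).1.1 = Y.graph.ini (f.horIni c).1.1 ∧
    Y.graph.ter (f.bot c).1.1 = Y.graph.ini (f.horTer c).1.1 ∧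
    IsPath (G := f.vert) (Y.graph.ter (f.horIni c).1.1) (f.top c)
      (Y.graph.ter (f.horTer c).1.1) := by
  obtain ⟨x, hx⟩ := Y.bdry_closed c
  rw [f.bdry_eq c] at hx
  obtain ⟨h1, h2, h⟩ := hx
  obtain ⟨z, h3, h4, h5⟩ := isPath_append.1 h
  have h4 : Y.graph.ter (f.horIni c).1.1 = z := h4
  refine ⟨h1.trans h5.symm, h2.symm, ?_⟩
  rw [h4]
  have h6 : IsPath (G := f.vert) (Y.graph.ter (f.horTer c).1.1) (revPath (f.top c)) z :=
    f.isPath_vert_iff.2 h3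
  have h7 := h6.revPath
  rwa [revPath_revPath] at h7

variable {f} in
lemma vert_ext {e e' : f.vert.E} (h : e.1.1 = e'.1.1) : e = e' := by
  refine Subtype.ext (Prod.ext h (Sum.inl_injective (β := H.verts) ?_))
  exact e.2.symm.trans ((congrArg f.emap h).trans e'.2)

variable {f} in
lemma hor_ext {h h' : f.Hor} (hh : h.1.1 = h'.1.1) : h = h' := by
  refine Subtype.ext (Prod.ext hh (Sum.inr_injective (α := F.E) ?_))
  exact h.2.symm.trans ((congrArg f.emap hh).trans h'.2)

lemma vert_ne_hor (e : f.vert.E) (h : f.Hor) : e.1.1 ≠ h.1.1 := by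
  intro heq
  have h1 := e.2
  rw [heq, h.2] at h1
  cases h1

lemma map_fst_bdry (c : Y.C) : (Y.bdry c).map Prod.fst = (f.bot c).1.1 :: (f.horTer c).1.1 ::
    ((revPath (f.top c)).map (fun d => d.1.1.1) ++ [(f.horIni c).1.1]) := by
  rw [f.bdry_eq c]
  simp [vertDart, Function.comp_def]

lemma occurrence_vert {c : Y.C} {i : ℕ} {e : f.vert.E}
    (h : ((Y.bdry c).map Prod.fst)[i]? = some e.1.1) :
    (i = 0 ∧ f.bot c = e) ∨ ∃ d ∈ f.top c, d.1 = e := by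
  rw [f.map_fst_bdry] at h
  rcases i with _ | _ | i
  · exact Or.inl ⟨rfl, vert_ext (Option.some.inj h)⟩
  · exact absurd (Option.some.inj h).symm (f.vert_ne_hor _ _)
  · right
    have h1 := List.mem_of_getElem? (l := List.map (fun d : f.vert.Dart => d.1.1.1)
      (revPath (f.top c)) ++ [(f.horIni c).1.1]) (i := i) (by simpa using h)
    rcases List.mem_append.1 h1 with h1 | h1
    · obtain ⟨d, hd, hde⟩ := List.mem_map.1 h1
      exact ⟨rev d, mem_revPath.1 hd, vert_ext hde⟩
    · exact absurd (List.mem_singleton.1 h1) (f.vert_ne_hor _ _)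

lemma occurrence_hor {c : Y.C} {i : ℕ} {h : f.Hor}
    (hi : ((Y.bdry c).map Prod.fst)[i]? = some h.1.1) :
    (i = 1 ∧ f.horTer c = h) ∨ (i = (f.top c).length + 2 ∧ f.horIni c = h) := by
  rw [f.map_fst_bdry] at hi
  rcases i with _ | _ | i
  · exact absurd (Option.some.inj hi) (f.vert_ne_hor _ _)
  · exact Or.inl ⟨rfl, hor_ext (Option.some.inj hi)⟩
  · right
    simp only [List.getElem?_cons_succ] at hi
    rcases lt_or_ge i (List.map (fun d : f.vert.Dart => d.1.1.1) (revPath (f.top c))).length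
      with h1 | h1
    · rw [List.getElem?_append_left h1] at hi
      obtain ⟨d, -, hd⟩ := List.mem_map.1 (List.mem_of_getElem? hi)
      exact absurd hd (f.vert_ne_hor _ _)
    · rw [List.getElem?_append_right h1] at hi
      have h2 := List.mem_of_getElem? hi
      obtain ⟨h3, -⟩ := List.getElem?_eq_some_iff.1 hi
      rw [List.length_singleton] at h3
      refine ⟨?_, hor_ext (List.mem_singleton.1 h2).symm⟩
      simp only [List.length_map, revPath, List.length_reverse] at h1 h3
      omega

lemma occurrence_horTer (c : Y.C) : ((Y.bdry c).map Prod.fst)[1]? = some (f.horTer c).1.1 := by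
  rw [f.map_fst_bdry]
  rfl

lemma occurrence_horIni (c : Y.C) :
    ((Y.bdry c).map Prod.fst)[(f.top c).length + 2]? = some (f.horIni c).1.1 := by
  rw [f.map_fst_bdry]
  simp only [List.getElem?_cons_succ]
  rw [List.getElem?_append_right (by simp [revPath])]
  simp [revPath]

variable {f}

/-- The bottom edge determines both the image 2-cell and the vertex of the corner at position 0,
where the immersion is injective. -/
lemma IsImmersion.bot_injective (hf : f.IsImmersion) : Function.Injective f.bot := by
  intro c c' h
  have h1 : (Y.bdry c)[0]? = some ((f.bot c).1.1, true) := by rw [f.bdry_eq c]; rfl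
  have h2 : (Y.bdry c')[0]? = some ((f.bot c').1.1, true) := by rw [f.bdry_eq c']; rfl
  obtain ⟨hi, h1⟩ := List.getElem?_eq_some_iff.1 h1
  obtain ⟨hi', h2⟩ := List.getElem?_eq_some_iff.1 h2
  refine hf.injective_on_corners c c' 0 hi hi' (Subtype.ext ?_) (by rw [h1, h2, h])
  rw [← f.bot_lab, ← f.bot_lab, h]

lemma IsImmersion.hor_injective (hf : f.IsImmersion) :
    Function.Injective fun h : f.Hor => Y.graph.ini h.1.1 := by
  intro h h' hh
  have key : ∀ h : f.Hor, h.1.2.1 = f.vmap (Y.graph.ini h.1.1) := fun h => by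
    have := f.ini_emap h.1.1
    rw [h.2] at this
    exact this
  have hlab : h.1.2 = h'.1.2 := Subtype.ext (by rw [key, key]; exact congrArg f.vmap hh)
  exact hor_ext (congrArg Prod.fst (hf.injective_on_darts (h.1.1, true) (h'.1.1, true) hh
    (by rw [h.2, h'.2, hlab]) rfl) :)

variable (f) in
/-- The immersed `2`-complex `Y` as the mapping torus of a partial map. -/
noncomputable def toPartialLift (hf : f.IsImmersion) : PartialLift ψ where
  Γ := f.vert
  S := { V := f.Hor, E := Y.C, ini := f.horIni, ter := f.horTer }
  φ :=
    { vmap := fun h => Y.graph.ter h.1.1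
      emap := f.top
      isPath := fun c => (f.ends_eq c).2.2
      ne_nil := fun c h => ψ.ne_nil (f.cmap c) (by rw [← f.map_top, h]; rfl) }
  baseV h := Y.graph.ini h.1.1
  baseE := f.bot
  ini_baseE c := (f.ends_eq c).1
  ter_baseE c := (f.ends_eq c).2.1
  baseV_injective := hf.hor_injective
  baseE_injective := hf.bot_injective
  labV := f.vmap
  labE e := e.1.2
  ini_labE e := by
    have := f.ini_emap e.1.1
    rw [e.2] at this
    exact this
  ter_labE e := by
    have := f.ter_emap e.1.1
    rw [e.2] at this
    exact this
  lab_injective d d' h h1 h2 := by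
    have h3 := hf.injective_on_darts (f.vertDart d) (f.vertDart d') h
      (by rw [vertDart, vertDart, d.1.2, d'.1.2, h1]) h2
    exact Prod.ext (vert_ext (congrArg Prod.fst h3 :)) h2
  lab_mem c := by
    rw [f.bot_lab]
    exact (f.cmap c).2
  map_emap c := by
    refine (f.map_top c).trans (congrArg ψ.emap (Subtype.ext (f.bot_lab c).symm))

/-- Traversals of a horizontal edge by 2-cells are the half-edges of `S` at the corresponding
vertex, so the absence of free edges makes `S` a core. -/
lemma isFull_toPartialLift (hf : f.IsImmersion) (hconn : Y.graph.Connected)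
    (hfree : ∀ e, ¬ Y.IsFreeEdge e) (hiso : ∀ e, ¬ Y.IsIsolatedEdge e)
    (hne : Nonempty Y.graph.E) : (f.toPartialLift hf).IsFull where
  isCore := by
    have key : ∀ (h : f.Hor) (c : Y.C) (i : ℕ), ((Y.bdry c).map Prod.fst)[i]? = some h.1.1 →
        ∃ s : (f.toPartialLift hf).S.Dart, src s = h ∧
          (s.1 = c ∧ if s.2 then i = (f.top c).length + 2 else i = 1) := by
      intro h c i hi
      rcases f.occurrence_hor hi with ⟨h1, h2⟩ | ⟨h1, h2⟩
      · exact ⟨(c, false), h2, rfl, h1⟩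
      · exact ⟨(c, true), h2, rfl, h1⟩
    have other : ∀ (h : f.Hor) (c : Y.C) (i : ℕ), ((Y.bdry c).map Prod.fst)[i]? = some h.1.1 →
        ∃ s : (f.toPartialLift hf).S.Dart, src s = h ∧
          ¬ (s.1 = c ∧ if s.2 then i = (f.top c).length + 2 else i = 1) := by
      intro h c i hi
      obtain ⟨c', i', hi', hne⟩ := exists_other_occurrence (hfree _) hi
      obtain ⟨s, h1, h2, h3⟩ := key h c' i' hi'
      refine ⟨s, h1, ?_⟩
      rintro ⟨h4, h5⟩
      obtain rfl : c' = c := h2.symm.trans h4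
      refine hne rfl ?_
      split_ifs at h3 h5 <;> omega
    rintro ⟨c, _ | _⟩ -
    · obtain ⟨s, h1, h2⟩ := other _ c _ (f.occurrence_horTer c)
      refine ⟨s, trivial, h1, ?_⟩
      rintro rfl
      exact h2 ⟨rfl, rfl⟩
    · obtain ⟨s, h1, h2⟩ := other _ c _ (f.occurrence_horIni c)
      refine ⟨s, trivial, h1, ?_⟩
      rintro rfl
      exact h2 ⟨rfl, rfl⟩
  covered e := by
    obtain ⟨c, i, hi⟩ := exists_occurrence (hiso e.1.1)
    rcases f.occurrence_vert hi with ⟨rfl, rfl⟩ | h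
    -- Only one 2-cell has this edge as its bottom, so a second traversal must be in a top path.
    · obtain ⟨c', i', hi', hne⟩ := exists_other_occurrence (hfree _) hi
      rcases f.occurrence_vert hi' with ⟨rfl, h⟩ | h
      · exact absurd rfl (hne (hf.bot_injective h))
      · exact ⟨c', h⟩
    · exact ⟨c, h⟩
  exists_dart v := by
    obtain ⟨d, rfl⟩ : ∃ d : Y.graph.Dart, src d = v := by
      obtain ⟨e⟩ := hne
      obtain ⟨l, hl⟩ := hconn.2 v (Y.graph.ini e)
      cases l with
      | nil => exact ⟨(e, true), (show v = _ from hl).symm⟩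
      | cons d l => exact ⟨d, hl.1⟩
    obtain ⟨e, b⟩ := d
    rcases he : f.emap e with a | w
    · exact ⟨(⟨(e, a), he⟩, b), by cases b <;> rfl⟩
    · obtain ⟨s, hs⟩ : ∃ s : (f.toPartialLift hf).S.Dart, src s = (⟨(e, w), he⟩ : f.Hor) := by
        obtain ⟨c, i, hi⟩ := exists_occurrence (hiso e)
        rcases f.occurrence_hor (h := ⟨(e, w), he⟩) hi with ⟨-, h⟩ | ⟨-, h⟩
        · exact ⟨(c, false), h⟩
        · exact ⟨(c, true), h⟩
      cases b with
      | true => exact ⟨(f.toPartialLift hf).base s, by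
          rw [PartialLift.src_base, hs]; rfl⟩
      | false =>
        obtain ⟨x, l, hl⟩ :=
          List.exists_cons_of_ne_nil ((f.toPartialLift hf).φ.dartMap_ne_nil s)
        have hpath := (f.toPartialLift hf).φ.isPath_dartMap s
        rw [hl, hs] at hpath
        exact ⟨x, hpath.1⟩

variable (f) in
lemma card_edges [Finite Y.graph.E] :
    Finite f.vert.E ∧ Finite f.Hor ∧
      Nat.card Y.graph.E = Nat.card f.vert.E + Nat.card f.Hor := by
  have h1 : Finite f.vert.E := Finite.of_injective (fun e : f.vert.E => e.1.1) fun _ _ => vert_ext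
  have h2 : Finite f.Hor := Finite.of_injective (fun h : f.Hor => h.1.1) fun _ _ => hor_ext
  refine ⟨h1, h2, ?_⟩
  rw [← Nat.card_sum]
  symm
  refine Nat.card_congr (Equiv.ofBijective
    (Sum.elim (fun e : f.vert.E => e.1.1) fun h : f.Hor => h.1.1) ⟨?_, ?_⟩)
  · exact Function.Injective.sumElim (fun _ _ => vert_ext) (fun _ _ => hor_ext)
      fun e h => f.vert_ne_hor e h
  · intro e
    rcases he : f.emap e with a | w
    · exact ⟨Sum.inl ⟨(e, a), he⟩, rfl⟩
    · exact ⟨Sum.inr ⟨(e, w), he⟩, rfl⟩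

end CombMap

lemma hasTrivialPi1_of_isEmpty {Y : TwoComplex.{u}} (h : IsEmpty Y.graph.E) :
    Y.HasTrivialPi1 := by
  intro v
  have hloop : Subsingleton (Y.Loop v) := by
    have : ∀ l : List Y.graph.Dart, l = [] := fun l => by
      cases l with
      | nil => rfl
      | cons d l => exact h.elim d.1
    exact ⟨fun a b => Subtype.ext ((this _).trans (this _).symm)⟩
  exact Quot.Subsingleton

end TwoComplex

/-! ### The constant for negative immersions. -/

lemma negativeImmersions_of_isForest {F : MGraph.{u}} [Finite F.V] [Finite F.E]
    {H : Subgraph F} {ψ : CellularMap H.toGraph F} (hψ : ψ.IsImmersion) {n : ℕ}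
    (hn : (ψ.iteratedPreimage n).IsForest) : (mappingTorus ψ).NegativeImmersions := by
  obtain ⟨K, hK⟩ := PartialLift.card_le_mul_card_frontier hψ hn
  -- With `B` the size of the frontier, `|Y|₂ ≤ K B` and `B ≤ -2χ(Y)`; using `K + 1` keeps the
  -- denominator positive when `K = 0`.
  refine ⟨1 / (2 * (K + 1)), by positivity, fun Y f hf hfin hconn hcoll hiso => ?_⟩
  rcases isEmpty_or_nonempty Y.graph.E with hE | hE
  · exact Or.inl (TwoComplex.hasTrivialPi1_of_isEmpty hE)
  right
  obtain ⟨hV, hEfin, hC⟩ := hfin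
  obtain ⟨h1, h2, hcard⟩ := f.card_edges
  have hfull := f.isFull_toPartialLift hf hconn hcoll.1 hiso hE
  have hle := hK _ hfull hV
  have : Finite (f.toPartialLift hf).Γ.V := hV
  have : Finite (f.toPartialLift hf).Γ.E := h1
  have : Finite (f.toPartialLift hf).S.E := hC
  have : Finite (f.toPartialLift hf).S.V := h2
  have hfr := PartialLift.card_frontier_le hfull hψ
  change 2 * Nat.card Y.C + _ + 2 * Nat.card Y.graph.V ≤
    2 * Nat.card f.vert.E + 2 * Nat.card f.Hor at hfr
  change Nat.card Y.C ≤ _ at hle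
  generalize Nat.card {v // (f.toPartialLift hf).IsFrontier v} = B at hfr hle
  have hchi : (B : ℝ) ≤ -2 * Y.eulerChar := by
    have : (B : ℤ) ≤ -2 * Y.eulerChar := by
      rw [TwoComplex.eulerChar]
      omega
    exact_mod_cast this
  have hle' : (Nat.card Y.C : ℝ) ≤ K * B := by exact_mod_cast hle
  rw [neg_mul, le_neg, one_div, ← div_eq_inv_mul, div_le_iff₀ (by positivity)]
  have hB : (0 : ℝ) ≤ B := by positivity
  nlinarith [mul_le_mul_of_nonneg_left hchi (by positivity : (0 : ℝ) ≤ (K : ℝ) + 1)]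

end PartialTorus

theorem mainTheorem1 (F : PartialTorus.MGraph.{u}) [Finite F.V] [Finite F.E] (hF : F.Connected)
    (H : F.Subgraph) (ψ : PartialTorus.CellularMap H.toGraph F) (hψ : ψ.IsImmersion) :
    (PartialTorus.mappingTorus ψ).NegativeImmersions ↔ ψ.directedHeight < ⊤ := by
  rw [PartialTorus.CellularMap.directedHeight_lt_top_iff]
  constructor
  · intro h
    by_contra! hno
    obtain ⟨A, hA⟩ := PartialTorus.CellularMap.exists_isInvariantCore hψ hno
    exact PartialTorus.CellularMap.not_negativeImmersions hψ hA h
  · rintro ⟨n, hn⟩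
    exact PartialTorus.negativeImmersions_of_isForest hψ hn
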